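/- For permutations $\pi,\rho\in S_n$ let $$V_n=V_n(\pi,\rho)=\sum_{k=1}^n\ \sum_{1\le i_1<\cdots<i_k\le n}\ \sum_{1\le j_1<\cdots<j_k\le n}\mathbf 1\big(\pi(i_1)=\rho(j_1),\dots,\pi(i_k)=\rho(j_k)\big).$$ For each $n$ let $\pi$ be a uniformly random permutation in $S_n$ and let $\rho$ be a random permutation in $S_n$, independent of $\pi$, with an arbitrary distribution (which may vary with $n$). Write $a_n\sim b_n$ for $\lim_{n\to\infty}a_n/b_n=1$. Then the following hold. (0) For every $n$, $V_n$ has the same law as the number of nonempty increasing subsequences of a uniformly random permutation $\tau\in S_n$, that is, as $\sum_{k=1}^n\sum_{1\le l_1<\cdots<l_k\le n}\mathbf 1(\tau(l_1)<\cdots<\tau(l_k))$. (i) For every $n$, $$\mathbb E[V_n]=\sum_{k=1}^n\binom nk^2\frac{(n-k)!}{n!},\qquad\text{and}\qquad \mathbb E[V_n]\sim\frac{1}{2\sqrt{\pi e}\,n^{1/4}}\,e^{2\sqrt n}\quad(n\to\infty).$$ (In the last formula $\pi$ denotes the number $3.14159\ldots$) (ii) For every $n$, $$\mathrm{Var}(V_n)=\sum_{\substack{k,l\ge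 0\\ k+l\le n}}4^l\,\frac1{(k+l)!}\binom n{k+l}\binom{\frac{k+1}2+l-1}{l}-\Bigg(\sum_{k=0}^n\binom nk^2\frac{(n-k)!}{n!}\Bigg)^2,$$ where $\binom xl=x(x-1)\cdots(x-l+1)/l!$ for real $x$. Moreover there is a constant $C>0$, depending neither on $n$ nor on the distributions of the permutations $\rho$, such that $$\mathrm{Var}(V_n)\sim\frac{C}{n^{1/4}}\,e^{2\sqrt{2+\sqrt5}\,\sqrt n}\quad(n\to\infty).$$ (iii) For every $\varepsilon>0$, $$\mathbb P\left(\left|\frac{V_n-\mathbb E[V_n]}{\sqrt{\mathrm{Var}(V_n)}}\right|>\varepsilon\right)\longrightarrow 0\quad(n\to\infty),$$ i.e. the normalised fluctuation tends to $0$ in probability. -/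

import Mathlib

open MeasureTheory ProbabilityTheory Filter Asymptotics
open scoped Topology Nat

/-- The finite set `S_n` of permutations carries the discrete σ-algebra. -/
instance permMeasurableSpace (n : ℕ) : MeasurableSpace (Equiv.Perm (Fin n)) := ⊤

/-- The uniform law on the permutations of `n` points. -/
noncomputable def uniformPerm (n : ℕ) : Measure (Equiv.Perm (Fin n)) :=
  (PMF.uniformOfFintype (Equiv.Perm (Fin n))).toMeasure

open Classical in
/-- Steele's statistic: the number of triples `(k, i, j)`, with `1 ≤ k ≤ n` and with `i`, `j`
strictly increasing `k`-tuples of positions, such that `π (i s) = ρ (j s)` for every `s`. -/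
noncomputable def steeleV (n : ℕ) (π ρ : Equiv.Perm (Fin n)) : ℕ :=
  ∑ k ∈ Finset.Icc 1 n, ∑ i : Fin k ↪o Fin n, ∑ j : Fin k ↪o Fin n,
    if ∀ s : Fin k, π (i s) = ρ (j s) then 1 else 0

open Classical in
/-- The number of nonempty increasing subsequences of `τ`: the number of pairs `(k, l)`, with
`1 ≤ k ≤ n` and `l` a strictly increasing `k`-tuple of positions, such that
`τ (l 1) < ⋯ < τ (l k)`. -/
noncomputable def increasingSubseqCount (n : ℕ) (τ : Equiv.Perm (Fin n)) : ℕ :=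
  ∑ k ∈ Finset.Icc 1 n, ∑ l : Fin k ↪o Fin n,
    if StrictMono (fun s : Fin k => τ (l s)) then 1 else 0

/-! A match between positions of `π` and `ρ` is an increasing subsequence of `τ = ρ⁻¹ * π`, and `τ`
is uniform whatever the law of `ρ`. So everything concerns the number `N` of increasing position
sets of a uniform `τ`; `N` includes the empty set, so it is the statistic plus one.

A fixed `k`-set is increasing with probability `1 / k!`, which gives the mean `∑ C(n,k) / k!`. For
the second moment, pairs `(S, T)` of increasing sets are grouped by their union `U`. The relative
order of `τ` on `U` is uniform, so the second moment is `∑ C(n,k) / k! * p_k`, where `p_k` counts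
the triples `(σ, S, T)` in which `σ` permutes `k` points and increases on each of `S`, `T`, which
together cover all points. Cutting at the least element of `S ∩ T` gives the renewal equation `p = B
+ x B p` with `B = (1 - 4x)^(-1/2)` (`card_increasingCovers`). Thus `p = ((1 - 4x)^(1/2) - x)⁻¹`.
Expanding in powers of `x B` gives the exact variance; multiplying by the conjugate gives a linear
recurrence with characteristic roots `2 ± √5`, so `p_m` grows like `A (2 + √5)^m`.

Both moments are now Laguerre sums `∑ C(n,k) y^k r_k / k!` with `r_k` convergent, for `y = 1` and `y
= 2 + √5`. Writing `(k!)^2` as `(2k)!` over a central binomial exhibits Poisson weights of parameter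
`2√(yn)` at even integers. These concentrate at `k ∼ √(yn)`, where the remaining factors have limits
(`tendsto_laguerre_sum`).

Since `2 + √5 > 4`, the squared mean is negligible against the second moment. The standard deviation
therefore dwarfs the mean, and Markov's inequality makes the normalised fluctuation vanish. -/

/-! ### Concentration of Poisson weights on the even integers. -/

/-- Twice the Poisson weight of parameter `2 * z` at the even integer `2 * k`. -/
noncomputable def evenPoissonWeight (z : ℝ) (k : ℕ) : ℝ :=
  2 * Real.exp (-(2 * z)) * ((2 * z) ^ (2 * k) / ((2 * k)! : ℝ))

lemma evenPoissonWeight_nonneg {z : ℝ} (k : ℕ) : 0 ≤ evenPoissonWeight z k := by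
  unfold evenPoissonWeight
  have : 0 ≤ (2 * z) ^ (2 * k) := (even_two_mul k).pow_nonneg _
  positivity

lemma hasSum_evenPoissonWeight (z : ℝ) :
    HasSum (evenPoissonWeight z) (1 + Real.exp (-(4 * z))) := by
  have h := (Real.hasSum_cosh (2 * z)).mul_left (2 * Real.exp (-(2 * z)))
  have hv : 2 * Real.exp (-(2 * z)) * Real.cosh (2 * z) = 1 + Real.exp (-(4 * z)) := by
    rw [Real.cosh_eq]
    have h1 : Real.exp (-(2 * z)) * Real.exp (2 * z) = 1 := by
      rw [← Real.exp_add]; simp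
    have h2 : Real.exp (-(2 * z)) * Real.exp (-(2 * z)) = Real.exp (-(4 * z)) := by
      rw [← Real.exp_add]; ring_nf
    linear_combination h1 + h2
  rwa [hv] at h

lemma hasSum_exp_real (l : ℝ) : HasSum (fun j : ℕ => l ^ j / (j ! : ℝ)) (Real.exp l) := by
  rw [Real.exp_eq_exp_ℝ]; exact NormedSpace.expSeries_div_hasSum_exp l

lemma hasSum_nat_mul_exp (l : ℝ) :
    HasSum (fun j : ℕ => (j : ℝ) * (l ^ j / (j ! : ℝ))) (l * Real.exp l) := by
  rw [← hasSum_nat_add_iff' 1]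
  simp only [Finset.range_one, Finset.sum_singleton, Nat.cast_zero, zero_mul, sub_zero]
  refine ((hasSum_exp_real l).mul_left l).congr_fun fun j => ?_
  rw [Nat.factorial_succ]; push_cast
  field_simp
  ring

lemma hasSum_nat_mul_pred_mul_exp (l : ℝ) :
    HasSum (fun j : ℕ => (j : ℝ) * (j - 1) * (l ^ j / (j ! : ℝ))) (l ^ 2 * Real.exp l) := by
  rw [← hasSum_nat_add_iff' 1]
  simp only [Finset.range_one, Finset.sum_singleton, Nat.cast_zero, zero_mul, sub_zero]
  rw [sq, mul_assoc]
  refine ((hasSum_nat_mul_exp l).mul_left l).congr_fun fun j => ?_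
  rw [Nat.factorial_succ]; push_cast
  field_simp
  ring

lemma hasSum_sub_sq_mul_exp (l : ℝ) :
    HasSum (fun j : ℕ => ((j : ℝ) - l) ^ 2 * (l ^ j / (j ! : ℝ))) (l * Real.exp l) := by
  have hv : l * Real.exp l = l ^ 2 * Real.exp l + (1 - 2 * l) * (l * Real.exp l) +
      l ^ 2 * Real.exp l := by ring
  rw [hv]
  refine HasSum.congr_fun (((hasSum_nat_mul_pred_mul_exp l).add
    ((hasSum_nat_mul_exp l).mul_left (1 - 2 * l))).add ((hasSum_exp_real l).mul_left (l ^ 2)))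
    fun j => ?_
  ring

/-- The Poisson variance at parameter `2z`, with the odd terms discarded: `(2k - 2z)^2 = 4 (k -
z)^2`, and the factor `4` beats the normalisation `2`. -/
lemma summable_sub_sq_mul_evenPoissonWeight {z : ℝ} (hz : 0 ≤ z) :
    Summable (fun k : ℕ => ((k : ℝ) - z) ^ 2 * evenPoissonWeight z k) ∧
    ∑' k : ℕ, ((k : ℝ) - z) ^ 2 * evenPoissonWeight z k ≤ z := by
  have h := hasSum_sub_sq_mul_exp (2 * z)
  have hi : Function.Injective (fun k : ℕ => 2 * k) := fun a b h => by simpa using h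
  have hs := h.summable.comp_injective hi
  have hle := hs.tsum_le_tsum_of_inj (fun k : ℕ => 2 * k) hi (fun c _ => by positivity)
    (fun i => le_rfl) h.summable
  have he : (fun k : ℕ => ((k : ℝ) - z) ^ 2 * evenPoissonWeight z k) =
      fun k => (Real.exp (-(2 * z)) / 2) * ((fun j : ℕ => ((j : ℝ) - 2 * z) ^ 2 *
        ((2 * z) ^ j / (j ! : ℝ))) ∘ fun k : ℕ => 2 * k) k := by
    funext k
    simp only [evenPoissonWeight, Function.comp]
    push_cast
    ring
  rw [he]
  refine ⟨hs.mul_left _, ?_⟩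
  rw [tsum_mul_left]
  rw [h.tsum_eq] at hle
  calc _ ≤ Real.exp (-(2 * z)) / 2 * (2 * z * Real.exp (2 * z)) := by gcongr; exact hle
    _ = z * (Real.exp (-(2 * z)) * Real.exp (2 * z)) := by ring
    _ = z := by rw [← Real.exp_add]; simp

/-- The pairs `(n, k)` with `n → ∞` and `k ∼ z n`. -/
noncomputable def ratioFilter (z : ℕ → ℝ) : Filter (ℕ × ℕ) :=
  comap Prod.fst atTop ⊓ comap (fun p => (p.2 : ℝ) / z p.1) (𝓝 1)

/-- Laplace's method in Chebyshev form. Near `k = z` the factor `g` is close to `L`; away from it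
the weights have mass `O(1/z)`, which absorbs a growth of `g` of order `√z`. That growth must be
allowed, because the Stirling factor used later is of this size at small `k`. -/
lemma tendsto_tsum_evenPoissonWeight {z : ℕ → ℝ} (hz : Tendsto z atTop atTop)
    {g : ℕ → ℕ → ℝ} {M L : ℝ} (hM : ∀ n k, |g n k| ≤ M * √(z n))
    (hg : Tendsto (fun p : ℕ × ℕ => g p.1 p.2) (ratioFilter z) (𝓝 L)) :
    Tendsto (fun n => ∑' k, g n k * evenPoissonWeight (z n) k) atTop (𝓝 L) := by
  have hexp : Tendsto (fun n => Real.exp (-(4 * z n))) atTop (𝓝 0) :=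
    Real.tendsto_exp_neg_atTop_nhds_zero.comp (hz.const_mul_atTop (by norm_num : (0 : ℝ) < 4))
  have hmain : Tendsto (fun n => ∑' k, g n k * evenPoissonWeight (z n) k
      - L * (1 + Real.exp (-(4 * z n)))) atTop (𝓝 0) := by
    rw [Metric.tendsto_atTop']
    intro ε hε
    have hev : ∀ᶠ p in ratioFilter z, |g p.1 p.2 - L| < ε / 4 := by
      have := Metric.tendsto_nhds.1 hg (ε / 4) (by positivity)
      simpa [Real.dist_eq] using this
    rw [ratioFilter, Filter.Eventually, Filter.mem_inf_iff_superset] at hev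
    obtain ⟨s, ⟨s', hs', hss⟩, t, ⟨t', ht', htt⟩, hst⟩ := hev
    obtain ⟨δ, hδ, hball⟩ := Metric.mem_nhds_iff.1 ht'
    have htail : Tendsto (fun n => (M * √(z n) + |L|) / (δ ^ 2 * z n)) atTop (𝓝 0) := by
      have h1 : Tendsto (fun x : ℝ => M / δ ^ 2 * (√x)⁻¹ + |L| / δ ^ 2 * x⁻¹) atTop
          (𝓝 (M / δ ^ 2 * 0 + |L| / δ ^ 2 * 0)) :=
        ((tendsto_inv_atTop_zero.comp Real.tendsto_sqrt_atTop).const_mul _).add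
          (tendsto_inv_atTop_zero.const_mul _)
      simp only [mul_zero, add_zero] at h1
      refine (h1.comp hz).congr' ?_
      filter_upwards [hz.eventually_gt_atTop 0] with n hn
      simp only [Function.comp]
      have : √(z n) ≠ 0 := (Real.sqrt_pos.2 hn).ne'
      have h2 : z n = √(z n) ^ 2 := (Real.sq_sqrt hn.le).symm
      generalize √(z n) = y at *
      rw [h2]
      field_simp
    obtain ⟨N, hN⟩ := eventually_atTop.1 ((((hz.eventually_gt_atTop 0).and
      (show ∀ᶠ n in atTop, n ∈ s' from hs')).and
      (htail.eventually (gt_mem_nhds (show (0 : ℝ) < ε / 4 by positivity)))))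
    refine ⟨N, fun n hn => ?_⟩
    obtain ⟨⟨hz0, hns⟩, hnt⟩ := hN n hn.le
    have hW := hasSum_evenPoissonWeight (z n)
    obtain ⟨hS, hS'⟩ := summable_sub_sq_mul_evenPoissonWeight hz0.le
    have hgw : Summable (fun k => g n k * evenPoissonWeight (z n) k) := by
      refine Summable.of_norm_bounded (hW.summable.mul_left (M * √(z n))) fun k => ?_
      rw [norm_mul, Real.norm_eq_abs, Real.norm_of_nonneg (evenPoissonWeight_nonneg k)]
      exact mul_le_mul_of_nonneg_right (hM n k) (evenPoissonWeight_nonneg k)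
    have hK : 0 ≤ (M * √(z n) + |L|) / (δ * z n) ^ 2 := by
      have := (abs_nonneg _).trans (hM n 0)
      positivity
    have hpt : ∀ k, |(g n k - L) * evenPoissonWeight (z n) k| ≤
        ε / 4 * evenPoissonWeight (z n) k + (M * √(z n) + |L|) / (δ * z n) ^ 2 *
          (((k : ℝ) - z n) ^ 2 * evenPoissonWeight (z n) k) := by
      intro k
      have hw := evenPoissonWeight_nonneg (z := z n) k
      rw [abs_mul, abs_of_nonneg hw, ← mul_assoc, ← add_mul]
      refine mul_le_mul_of_nonneg_right ?_ hw
      -- Near the centre the limit of `g` applies; otherwise `(k - z)^2 ≥ (δ z)^2`, so the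
      -- second-moment term alone dominates.
      by_cases hk : |(k : ℝ) / z n - 1| < δ
      · have : |g n k - L| < ε / 4 := by
          have hm : (n, k) ∈ s ∩ t := ⟨hss hns, htt (hball hk)⟩
          exact hst hm
        have h3 : 0 ≤ (M * √(z n) + |L|) / (δ * z n) ^ 2 * ((k : ℝ) - z n) ^ 2 := by positivity
        linarith
      · have h1 : δ * z n ≤ |(k : ℝ) - z n| := by
          have h2 : (k : ℝ) / z n - 1 = (k - z n) / z n := by field_simp
          rw [h2, abs_div, abs_of_pos hz0, not_lt, le_div_iff₀ hz0] at hk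
          exact hk
        have h4 : (δ * z n) ^ 2 ≤ ((k : ℝ) - z n) ^ 2 := by
          rw [← sq_abs ((k : ℝ) - z n)]
          gcongr
        have h5 : |g n k - L| ≤ M * √(z n) + |L| :=
          (abs_sub _ _).trans (add_le_add (hM n k) le_rfl)
        have h6 : M * √(z n) + |L| ≤
            (M * √(z n) + |L|) / (δ * z n) ^ 2 * ((k : ℝ) - z n) ^ 2 := by
          rw [div_mul_eq_mul_div, le_div_iff₀ (by positivity)]
          exact mul_le_mul_of_nonneg_left h4 ((abs_nonneg _).trans h5)
        linarith [show (0:ℝ) < ε / 4 by positivity]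
    have hbd := (hW.summable.mul_left (ε / 4)).add
      (hS.mul_left ((M * √(z n) + |L|) / (δ * z n) ^ 2))
    have heq : ∑' k, g n k * evenPoissonWeight (z n) k - L * (1 + Real.exp (-(4 * z n))) =
        ∑' k, (g n k - L) * evenPoissonWeight (z n) k := by
      rw [← hW.tsum_eq, ← tsum_mul_left, ← hgw.tsum_sub (hW.summable.mul_left L)]
      simp only [sub_mul]
    rw [Real.dist_eq, sub_zero, heq]
    calc |∑' k, (g n k - L) * evenPoissonWeight (z n) k|
        ≤ ∑' k, |(g n k - L) * evenPoissonWeight (z n) k| := by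
          have := norm_tsum_le_tsum_norm
            (f := fun k => (g n k - L) * evenPoissonWeight (z n) k)
            (Summable.of_nonneg_of_le (fun _ => norm_nonneg _) hpt hbd)
          simpa only [Real.norm_eq_abs] using this
      _ ≤ ∑' k, (ε / 4 * evenPoissonWeight (z n) k + (M * √(z n) + |L|) / (δ * z n) ^ 2 *
          (((k : ℝ) - z n) ^ 2 * evenPoissonWeight (z n) k)) :=
          (Summable.of_nonneg_of_le (fun _ => abs_nonneg _) hpt hbd).tsum_le_tsum hpt hbd
      _ = ε / 4 * (1 + Real.exp (-(4 * z n))) + (M * √(z n) + |L|) / (δ * z n) ^ 2 *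
          ∑' k : ℕ, (((k : ℝ) - z n) ^ 2 * evenPoissonWeight (z n) k) := by
          rw [(hW.summable.mul_left (ε / 4)).tsum_add (hS.mul_left _), tsum_mul_left,
            tsum_mul_left, hW.tsum_eq]
      _ ≤ ε / 4 * (1 + 1) + (M * √(z n) + |L|) / (δ * z n) ^ 2 * z n := by
          gcongr
          exact Real.exp_le_one_iff.2 (by linarith)
      _ = ε / 4 * (1 + 1) + (M * √(z n) + |L|) / (δ ^ 2 * z n) := by
          congr 1
          field_simp
      _ < ε := by linarith
  have h2 : Tendsto (fun n => L * (1 + Real.exp (-(4 * z n)))) atTop (𝓝 L) := by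
    simpa using (hexp.const_add 1).const_mul L
  simpa using hmain.add h2

/-! ### Asymptotics of Laguerre sums at negative arguments. -/

lemma tendsto_centralBinom_div_four_pow :
    Tendsto (fun k : ℕ => √(Real.pi * k) * ((k.centralBinom : ℝ) / 4 ^ k)) atTop (𝓝 1) := by
  have hs := Stirling.tendsto_stirlingSeq_sqrt_pi
  have hpi : √Real.pi ≠ 0 := (Real.sqrt_pos.2 Real.pi_pos).ne'
  have h2 : Tendsto (fun k : ℕ => Stirling.stirlingSeq (2 * k)) atTop (𝓝 (√Real.pi)) :=
    hs.comp (tendsto_id.const_mul_atTop' (by norm_num))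
  have h3 := ((h2.div (hs.pow 2) (pow_ne_zero 2 hpi)).const_mul (√Real.pi))
  have hv : √Real.pi * (√Real.pi / √Real.pi ^ 2) = 1 := by field_simp
  rw [hv] at h3
  refine h3.congr' ?_
  filter_upwards [eventually_gt_atTop 0] with k hk
  have hk' : (0 : ℝ) < k := by exact_mod_cast hk
  have hf : ((2 * k)! : ℝ) = k.centralBinom * (k ! : ℝ) ^ 2 := by
    have := Nat.choose_mul_factorial_mul_factorial (show k ≤ 2 * k by omega)
    rw [show 2 * k - k = k by omega] at this
    rw [Nat.centralBinom_eq_two_mul_choose, ← this]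
    push_cast; ring
  simp only [Pi.div_apply, Stirling.stirlingSeq]
  rw [hf]
  have e1 : √(2 * ((2 * k : ℕ) : ℝ)) = 2 * √(k : ℝ) := by
    rw [show (2 * ((2 * k : ℕ) : ℝ)) = 2 ^ 2 * k by push_cast; ring, Real.sqrt_mul (by positivity),
      Real.sqrt_sq (by norm_num)]
  have e2 : √(2 * (k : ℝ)) ^ 2 = 2 * k := Real.sq_sqrt (by positivity)
  have e3 : (((2 * k : ℕ) : ℝ) / Real.exp 1) ^ (2 * k) = 4 ^ k * ((k / Real.exp 1) ^ k) ^ 2 := by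
    push_cast
    rw [mul_div_assoc, mul_pow, pow_mul 2, pow_mul' ((k : ℝ) / Real.exp 1)]; norm_num
  rw [e1, e3, Real.sqrt_mul Real.pi_pos.le, div_pow (k ! : ℝ), mul_pow (√(2 * (k : ℝ))), e2]
  have e4 : √(k : ℝ) ^ 2 = k := Real.sq_sqrt hk'.le
  have : √(k : ℝ) ≠ 0 := (Real.sqrt_pos.2 hk').ne'
  have : (k / Real.exp 1) ^ k ≠ 0 := by positivity
  field_simp
  rw [e4]

lemma descFactorial_div_pow_eq_prod {n k : ℕ} (hk : k ≤ n) (hn : 0 < n) :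
    (n.descFactorial k : ℝ) / (n : ℝ) ^ k = ∏ i ∈ Finset.range k, (1 - (i : ℝ) / n) := by
  have hp : (n : ℝ) ^ k = ∏ _i ∈ Finset.range k, (n : ℝ) := by simp
  rw [Nat.descFactorial_eq_prod_range, Nat.cast_prod, hp, ← Finset.prod_div_distrib]
  refine Finset.prod_congr rfl fun i hi => ?_
  have : i ≤ n := (Finset.mem_range.1 hi).le.trans hk
  rw [Nat.cast_sub this]
  field_simp

lemma sum_range_cast_div (n k : ℕ) :
    ∑ i ∈ Finset.range k, (i : ℝ) / n = (k : ℝ) * (k - 1) / (2 * n) := by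
  rw [← Finset.sum_div]
  have : ∑ i ∈ Finset.range k, (i : ℝ) = (k : ℝ) * (k - 1) / 2 := by
    induction k with
    | zero => simp
    | succ k ih => rw [Finset.sum_range_succ, ih]; push_cast; ring
  rw [this]; ring

lemma descFactorial_div_pow_le_exp {n k : ℕ} (hk : k ≤ n) (hn : 0 < n) :
    (n.descFactorial k : ℝ) / (n : ℝ) ^ k ≤ Real.exp (-((k : ℝ) * (k - 1) / (2 * n))) := by
  rw [descFactorial_div_pow_eq_prod hk hn, ← sum_range_cast_div, ← Finset.sum_neg_distrib,
    Real.exp_sum]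
  refine Finset.prod_le_prod (fun i hi => ?_) fun i _ => Real.one_sub_le_exp_neg _
  have : i ≤ n := (Finset.mem_range.1 hi).le.trans hk
  rw [sub_nonneg]
  exact div_le_one_of_le₀ (by exact_mod_cast this) (by positivity)

/-- Factor by factor, with `x = i / n`: `1 / (1 - x) = 1 + x / (1 - x) ≤ exp (x / (1 - x))`, and
then `i ≤ k` makes the denominator uniform. -/
lemma exp_le_descFactorial_div_pow {n k : ℕ} (hk : k < n) :
    Real.exp (-((k : ℝ) * (k - 1) / (2 * n) * (1 - (k : ℝ) / n)⁻¹)) ≤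
      (n.descFactorial k : ℝ) / (n : ℝ) ^ k := by
  have hn : 0 < n := by omega
  have hn' : (0 : ℝ) < n := by exact_mod_cast hn
  rw [descFactorial_div_pow_eq_prod hk.le hn, ← sum_range_cast_div, Finset.sum_mul,
    ← Finset.sum_neg_distrib, Real.exp_sum]
  refine Finset.prod_le_prod (fun i hi => (Real.exp_pos _).le) fun i hi => ?_
  have hik : (i : ℝ) ≤ k := by exact_mod_cast (Finset.mem_range.1 hi).le
  have hkn : (0 : ℝ) < 1 - (k : ℝ) / n := by
    rw [sub_pos, div_lt_one hn']; exact_mod_cast hk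
  have hin : (0 : ℝ) < 1 - (i : ℝ) / n := hkn.trans_le (by gcongr)
  have h1 : (1 - (i : ℝ) / n)⁻¹ ≤ Real.exp ((i : ℝ) / n * (1 - (k : ℝ) / n)⁻¹) := by
    have h2 : (1 - (i : ℝ) / n)⁻¹ = (i : ℝ) / n * (1 - (i : ℝ) / n)⁻¹ + 1 := by
      have h3 := hin.ne'
      generalize (i : ℝ) / n = x at *
      field_simp
      ring
    rw [h2]
    refine (Real.add_one_le_exp _).trans (Real.exp_le_exp.2 ?_)
    gcongr
  rw [Real.exp_neg]
  exact inv_le_of_inv_le₀ hin h1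

lemma tendsto_ratioFilter_div (z : ℕ → ℝ) :
    Tendsto (fun p : ℕ × ℕ => (p.2 : ℝ) / z p.1) (ratioFilter z) (𝓝 1) :=
  tendsto_comap.mono_left inf_le_right

lemma tendsto_ratioFilter_fst (z : ℕ → ℝ) : Tendsto Prod.fst (ratioFilter z) atTop :=
  tendsto_comap.mono_left inf_le_left

lemma tendsto_ratioFilter_cast_snd {z : ℕ → ℝ} (hz : Tendsto z atTop atTop) :
    Tendsto (fun p : ℕ × ℕ => (p.2 : ℝ)) (ratioFilter z) atTop := by
  have hz' := hz.comp (tendsto_ratioFilter_fst z)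
  refine ((tendsto_ratioFilter_div z).pos_mul_atTop one_pos hz').congr' ?_
  filter_upwards [hz'.eventually_gt_atTop 0] with p hp
  simp only [Function.comp] at hp ⊢
  field_simp

/-- Both exponential bounds have exponent asymptotic to `-k^2 / (2n)`, because `k / n → 0`; and `k^2
∼ y n`. -/
lemma tendsto_descFactorial_div_pow {y : ℝ} (hy : 0 < y) :
    Tendsto (fun p : ℕ × ℕ => (p.1.descFactorial p.2 : ℝ) / (p.1 : ℝ) ^ p.2)
      (ratioFilter fun n => √(y * n)) (𝓝 (Real.exp (-(y / 2)))) := by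
  set F := ratioFilter fun n => √(y * n)
  have hz : Tendsto (fun n : ℕ => √(y * n)) atTop atTop :=
    Real.tendsto_sqrt_atTop.comp (tendsto_natCast_atTop_atTop.const_mul_atTop hy)
  have hq := tendsto_ratioFilter_div fun n => √(y * n)
  have hz' := hz.comp (tendsto_ratioFilter_fst fun n => √(y * n))
  have hk := tendsto_ratioFilter_cast_snd hz
  have hzinv := tendsto_inv_atTop_zero.comp hz'
  have hpos : ∀ᶠ p : ℕ × ℕ in F, 0 < p.1 :=
    (tendsto_ratioFilter_fst _).eventually (eventually_gt_atTop 0)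
  have hkn : Tendsto (fun p : ℕ × ℕ => (p.2 : ℝ) / p.1) F (𝓝 0) := by
    have := (hq.mul hzinv).mul_const y
    rw [mul_zero, zero_mul] at this
    refine this.congr' ?_
    filter_upwards [hpos] with p hp
    have hp' : (0 : ℝ) < p.1 := by exact_mod_cast hp
    have h1 : √(y * p.1) ^ 2 = y * p.1 := Real.sq_sqrt (by positivity)
    have h2 : √(y * p.1) ≠ 0 := (Real.sqrt_pos.2 (by positivity)).ne'
    simp only [Function.comp]
    field_simp
    rw [h1]; ring
  have hsq : Tendsto (fun p : ℕ × ℕ => (p.2 : ℝ) * (p.2 - 1) / (2 * p.1)) F (𝓝 (y / 2)) := by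
    have := ((hq.pow 2).mul_const (y / 2)).sub (hkn.mul_const (1 / 2))
    rw [one_pow, one_mul, zero_mul, sub_zero] at this
    refine this.congr' ?_
    filter_upwards [hpos] with p hp
    have hp' : (0 : ℝ) < p.1 := by exact_mod_cast hp
    rw [div_pow, Real.sq_sqrt (by positivity)]
    field_simp
  have hlt : ∀ᶠ p : ℕ × ℕ in F, p.2 < p.1 := by
    filter_upwards [hpos, hkn.eventually (gt_mem_nhds one_pos)] with p hp h
    rw [div_lt_one (by exact_mod_cast hp)] at h
    exact_mod_cast h
  have hup := (Real.continuous_exp.tendsto _).comp hsq.neg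
  have hlo := (Real.continuous_exp.tendsto _).comp
    (hsq.mul ((hkn.const_sub 1).inv₀ (by norm_num))).neg
  rw [sub_zero, inv_one, mul_one] at hlo
  refine tendsto_of_tendsto_of_tendsto_of_le_of_le' hlo hup ?_ ?_
  · filter_upwards [hlt] with p hp using exp_le_descFactorial_div_pow hp
  · filter_upwards [hlt] with p hp using descFactorial_div_pow_le_exp hp.le (by omega)

/-- The growth of `∑ k, n.choose k * y ^ k / k !`, a Laguerre polynomial at a negative argument. -/
noncomputable def laguerreScale (y : ℝ) (n : ℕ) : ℝ :=
  Real.exp (2 * √(y * n)) / (2 * √(Real.pi * √(y * n)))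

/-- With `z = √(yn)`, the term `C(n,k) y^k / k!` equals `(2z)^(2k) / (2k)!` times `centralBinom k /
4^k` times `n.descFactorial k / n^k`. The first factor is the Poisson weight. At `k ∼ z` the second
is about `1 / √(π z)`, which the scale cancels, and the third tends to `exp (-y / 2)`. -/
lemma tendsto_laguerre_sum {y : ℝ} (hy : 0 < y) {r : ℕ → ℝ} {B r₀ : ℝ} (hB : ∀ k, |r k| ≤ B)
    (hr : Tendsto r atTop (𝓝 r₀)) :
    Tendsto (fun n : ℕ => (∑ k ∈ Finset.range (n + 1),
      (n.choose k : ℝ) / (k ! : ℝ) * y ^ k * r k) / laguerreScale y n) atTop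
      (𝓝 (r₀ * Real.exp (-(y / 2)))) := by
  have hz : Tendsto (fun n : ℕ => √(y * n)) atTop atTop :=
    Real.tendsto_sqrt_atTop.comp (tendsto_natCast_atTop_atTop.const_mul_atTop hy)
  have hk := tendsto_ratioFilter_cast_snd hz
  have hkN : Tendsto (fun p : ℕ × ℕ => p.2) (ratioFilter fun n => √(y * n)) atTop :=
    tendsto_natCast_atTop_iff.1 hk
  set g : ℕ → ℕ → ℝ := fun n k => √(Real.pi * √(y * n)) * ((k.centralBinom : ℝ) / 4 ^ k) *
    ((n.descFactorial k : ℝ) / (n : ℝ) ^ k) * r k with hg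
  have hbound : ∀ n k, |g n k| ≤ (√Real.pi * B) * √(√(y * n)) := by
    intro n k
    have h1 : (k.centralBinom : ℝ) / 4 ^ k ≤ 1 :=
      div_le_one_of_le₀ (by exact_mod_cast Nat.centralBinom_le_four_pow k) (by positivity)
    have h2 : (n.descFactorial k : ℝ) / (n : ℝ) ^ k ≤ 1 :=
      div_le_one_of_le₀ (by exact_mod_cast Nat.descFactorial_le_pow n k) (by positivity)
    rw [hg]
    simp only
    rw [abs_mul, abs_of_nonneg (by positivity), Real.sqrt_mul Real.pi_pos.le]
    calc _ ≤ √Real.pi * √√(y * n) * 1 * 1 * B := by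
          gcongr
          exact hB k
      _ = _ := by ring
  have hlim : Tendsto (fun p : ℕ × ℕ => g p.1 p.2) (ratioFilter fun n => √(y * n))
      (𝓝 (r₀ * Real.exp (-(y / 2)))) := by
    have h1 := tendsto_centralBinom_div_four_pow.comp hkN
    have h2 := (Real.continuous_sqrt.tendsto _).comp
      ((tendsto_ratioFilter_div fun n => √(y * n)).inv₀ one_ne_zero)
    have h3 := tendsto_descFactorial_div_pow hy
    have h4 := hr.comp hkN
    have := ((h2.mul h1).mul h3).mul h4
    simp only [inv_one, Real.sqrt_one, one_mul] at this
    rw [mul_comm r₀]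
    refine this.congr' ?_
    filter_upwards [hk.eventually_gt_atTop 0] with p hp
    simp only [Function.comp, hg]
    congr 2
    rw [← mul_assoc]
    congr 1
    rw [← Real.sqrt_mul (by positivity)]
    congr 1
    field_simp
  refine (tendsto_tsum_evenPoissonWeight hz hbound hlim).congr' ?_
  filter_upwards [eventually_gt_atTop 0] with n hn
  have hn' : (0 : ℝ) < n := by exact_mod_cast hn
  rw [tsum_eq_sum (s := Finset.range (n + 1)), Finset.sum_div]
  · refine Finset.sum_congr rfl fun k _ => ?_
    have hf : ((2 * k)! : ℝ) = k.centralBinom * (k ! : ℝ) ^ 2 := by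
      have := Nat.choose_mul_factorial_mul_factorial (show k ≤ 2 * k by omega)
      rw [show 2 * k - k = k by omega] at this
      rw [Nat.centralBinom_eq_two_mul_choose, ← this]
      push_cast; ring
    have hd : (n.descFactorial k : ℝ) = k ! * n.choose k := by
      exact_mod_cast Nat.descFactorial_eq_factorial_mul_choose n k
    have hc : (k.centralBinom : ℝ) ≠ 0 := by exact_mod_cast k.centralBinom_ne_zero
    have hs : √(Real.pi * √(y * n)) ≠ 0 := by
      refine (Real.sqrt_pos.2 (mul_pos Real.pi_pos (Real.sqrt_pos.2 (by positivity)))).ne'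
    simp only [hg, evenPoissonWeight, laguerreScale]
    rw [hf, hd, pow_mul (2 * √(y * n)), mul_pow, Real.sq_sqrt (by positivity), Real.exp_neg,
      mul_pow, mul_pow, show ((2 : ℝ) ^ 2) = 4 by norm_num]
    field_simp
  · intro k hk
    have : n < k := by simpa using hk
    simp [hg, Nat.descFactorial_eq_zero_iff_lt.2 this]

/-! ### The coefficients of `((1 - 4x)^(1/2) - x)⁻¹` and their growth. -/

/-- The coefficient of `X ^ l` in `(1 - 4 X) ^ (-(k + 1) / 2)`. -/
noncomputable def halfPowerCoeff (k l : ℕ) : ℝ :=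
  4 ^ l * Ring.multichoose (((k : ℝ) + 1) / 2) l

lemma succ_mul_multichoose_succ (r : ℝ) (l : ℕ) :
    (l + 1) * Ring.multichoose r (l + 1) = (r + l) * Ring.multichoose r l := by
  have h1 := Ring.factorial_nsmul_multichoose_eq_ascPochhammer r (l + 1)
  have h0 := Ring.factorial_nsmul_multichoose_eq_ascPochhammer r l
  rw [Polynomial.ascPochhammer_smeval_eq_eval, nsmul_eq_mul] at h0 h1
  rw [ascPochhammer_succ_eval, ← h0, Nat.factorial_succ] at h1
  have : (l ! : ℝ) ≠ 0 := by positivity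
  push_cast at h1
  apply mul_left_cancel₀ this
  linear_combination h1

/-- Vandermonde's identity for `Ring.choose`, carried over by the reflection `multichoose r n =
(-1)^n choose (-r) n`. -/
lemma multichoose_real_add (r s : ℝ) (l : ℕ) :
    Ring.multichoose (r + s) l =
      ∑ p ∈ Finset.HasAntidiagonal.antidiagonal l, Ring.multichoose r p.1 * Ring.multichoose s p.2 := by
  have key : ∀ (r : ℝ) (n : ℕ), Ring.multichoose r n = (-1) ^ n * Ring.choose (-r) n := by
    intro r n
    rw [Ring.choose_neg', Units.smul_def, zsmul_eq_mul, ← mul_assoc]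
    have : ((-1 : ℝ)) ^ n * (((Int.negOnePow n : ℤˣ) : ℤ) : ℝ) = 1 := by
      rw [Int.cast_negOnePow_natCast, ← mul_pow]; norm_num
    rw [this, one_mul]
  rw [key, neg_add, Ring.add_choose_eq l (Commute.all _ _), Finset.mul_sum]
  refine Finset.sum_congr rfl fun p hp => ?_
  rw [key r, key s, ← Finset.HasAntidiagonal.mem_antidiagonal.1 hp, pow_add]
  ring

lemma halfPowerCoeff_zero_right (k : ℕ) : halfPowerCoeff k 0 = 1 := by
  simp [halfPowerCoeff]

lemma halfPowerCoeff_zero_left (l : ℕ) : halfPowerCoeff 0 l = l.centralBinom := by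
  induction l with
  | zero => simp [halfPowerCoeff]
  | succ l ih =>
    have h := succ_mul_multichoose_succ ((((0 : ℕ) : ℝ) + 1) / 2) l
    have h2 : ((l : ℝ) + 1) * ((l + 1).centralBinom : ℝ) = 2 * (2 * l + 1) * l.centralBinom := by
      exact_mod_cast Nat.succ_mul_centralBinom_succ l
    have h3 : (l : ℝ) + 1 ≠ 0 := by positivity
    apply mul_left_cancel₀ h3
    rw [h2, ← ih]
    unfold halfPowerCoeff
    rw [pow_succ]
    push_cast at h ⊢
    linear_combination 4 ^ l * 4 * h

lemma halfPowerCoeff_one_left (l : ℕ) : halfPowerCoeff 1 l = 4 ^ l := by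
  have : (((1 : ℕ) : ℝ) + 1) / 2 = 1 := by norm_num
  rw [halfPowerCoeff, this, Ring.multichoose_one, mul_one]

lemma halfPowerCoeff_succ_left (k l : ℕ) : halfPowerCoeff (k + 1) l =
    ∑ p ∈ Finset.HasAntidiagonal.antidiagonal l, halfPowerCoeff 0 p.1 * halfPowerCoeff k p.2 := by
  have : (((k + 1 : ℕ) : ℝ) + 1) / 2 = (((0 : ℕ) : ℝ) + 1) / 2 + ((k : ℝ) + 1) / 2 := by
    push_cast; ring
  rw [halfPowerCoeff, this, multichoose_real_add, Finset.mul_sum]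
  refine Finset.sum_congr rfl fun p hp => ?_
  rw [halfPowerCoeff, halfPowerCoeff, ← Finset.HasAntidiagonal.mem_antidiagonal.1 hp, pow_add]
  ring

/-- Multiplication by `1 - 4x` lowers `k` by two. -/
lemma halfPowerCoeff_add_two_succ (k l : ℕ) : halfPowerCoeff (k + 2) (l + 1) =
    halfPowerCoeff k (l + 1) + 4 * halfPowerCoeff (k + 2) l := by
  have : (((k + 2 : ℕ) : ℝ) + 1) / 2 = ((k : ℝ) + 1) / 2 + 1 := by push_cast; ring
  simp only [halfPowerCoeff]
  rw [this, Ring.multichoose_succ_succ]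
  ring

/-- The coefficient of `X ^ m` in `((1 - 4 X) ^ (1 / 2) - X)⁻¹`. -/
noncomputable def pairCoeff (m : ℕ) : ℝ :=
  ∑ p ∈ Finset.HasAntidiagonal.antidiagonal m, halfPowerCoeff p.1 p.2

lemma pairCoeff_zero : pairCoeff 0 = 1 := by
  simp [pairCoeff, halfPowerCoeff_zero_right]

lemma pairCoeff_succ_eq (m : ℕ) : pairCoeff (m + 1) = ((m + 1).centralBinom : ℝ) +
    ∑ p ∈ Finset.HasAntidiagonal.antidiagonal m, halfPowerCoeff (p.1 + 1) p.2 := by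
  rw [pairCoeff, Finset.Nat.sum_antidiagonal_succ, halfPowerCoeff_zero_left]

/-- The identity `p = B + x B p` for `B = (1 - 4x)^(-1/2)`, by reassociating a double convolution.
-/
lemma pairCoeff_renewal (m : ℕ) : pairCoeff (m + 1) = ((m + 1).centralBinom : ℝ) +
    ∑ p ∈ Finset.HasAntidiagonal.antidiagonal m, (p.1.centralBinom : ℝ) * pairCoeff p.2 := by
  rw [pairCoeff_succ_eq]
  congr 1
  simp only [halfPowerCoeff_succ_left, pairCoeff, ← halfPowerCoeff_zero_left, Finset.mul_sum]
  rw [Finset.sum_sigma', Finset.sum_sigma']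
  refine Finset.sum_bij' (fun x _ => ⟨(x.2.1, x.1.1 + x.2.2), (x.1.1, x.2.2)⟩)
    (fun x _ => ⟨(x.2.1, x.1.1 + x.2.2), (x.1.1, x.2.2)⟩) ?_ ?_ ?_ ?_ ?_
  · rintro ⟨⟨a, b⟩, ⟨c, d⟩⟩ h
    simp only [Finset.mem_sigma, Finset.HasAntidiagonal.mem_antidiagonal] at h ⊢
    obtain ⟨rfl, rfl⟩ := h
    exact ⟨Nat.add_left_comm c a d, trivial⟩
  · rintro ⟨⟨a, b⟩, ⟨c, d⟩⟩ h
    simp only [Finset.mem_sigma, Finset.HasAntidiagonal.mem_antidiagonal] at h ⊢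
    obtain ⟨rfl, rfl⟩ := h
    exact ⟨Nat.add_left_comm c a d, trivial⟩
  · rintro ⟨⟨a, b⟩, ⟨c, d⟩⟩ h
    simp only [Finset.mem_sigma, Finset.HasAntidiagonal.mem_antidiagonal] at h ⊢
    obtain ⟨-, rfl⟩ := h
    rfl
  · rintro ⟨⟨a, b⟩, ⟨c, d⟩⟩ h
    simp only [Finset.mem_sigma, Finset.HasAntidiagonal.mem_antidiagonal] at h ⊢
    obtain ⟨-, rfl⟩ := h
    rfl
  · rintro ⟨⟨a, b⟩, ⟨c, d⟩⟩ h
    rfl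

/-- Multiplying `p = ((1 - 4x)^(1/2) - x)⁻¹` by the conjugate gives `(1 - 4x - x^2) p = (1 -
4x)^(1/2) + x`. The inhomogeneous term is the coefficient of `(1 - 4x)^(1/2) = (1 - 4x) B`. -/
lemma pairCoeff_add_two (m : ℕ) : pairCoeff (m + 2) = 4 * pairCoeff (m + 1) + pairCoeff m +
    (((m + 2).centralBinom : ℝ) - 4 * ((m + 1).centralBinom : ℝ)) := by
  set T : ℕ → ℝ := fun m => ∑ p ∈ Finset.HasAntidiagonal.antidiagonal m, halfPowerCoeff (p.1 + 2) p.2 with hT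
  have h2 : ∀ m, pairCoeff (m + 2) = ((m + 2).centralBinom : ℝ) + 4 ^ (m + 1) + T m := by
    intro m
    rw [pairCoeff_succ_eq, Finset.Nat.sum_antidiagonal_succ]
    simp only [halfPowerCoeff_one_left, zero_add, add_assoc, hT]
  have hTs : ∀ m, T (m + 1) = 4 * T m + pairCoeff (m + 1) := by
    intro m
    simp only [hT, pairCoeff]
    rw [Finset.Nat.sum_antidiagonal_succ', Finset.Nat.sum_antidiagonal_succ']
    simp only [halfPowerCoeff_add_two_succ, halfPowerCoeff_zero_right, Finset.sum_add_distrib,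
      Finset.mul_sum]
    ring
  cases m with
  | zero =>
    have hT0 : T 0 = 1 := by simp [hT, halfPowerCoeff_zero_right]
    have h1 : pairCoeff 1 = ((1 : ℕ).centralBinom : ℝ) + 1 := by
      rw [pairCoeff_succ_eq]; simp [halfPowerCoeff_zero_right]
    rw [h2, hT0, h1, pairCoeff_zero]
    ring
  | succ m =>
    rw [h2 (m + 1), h2 m, hTs]
    ring

lemma tendsto_zero_of_abs_succ_le {u v : ℕ → ℝ} {q : ℝ} (hq0 : 0 ≤ q) (hq1 : q < 1)
    (hv : Tendsto v atTop (𝓝 0)) (h : ∀ m, |u (m + 1)| ≤ q * |u m| + |v m|) :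
    Tendsto u atTop (𝓝 0) := by
  rw [Metric.tendsto_atTop']
  intro ε hε
  have hε' : 0 < ε / 2 * (1 - q) := mul_pos (by positivity) (by linarith)
  obtain ⟨N, hN⟩ := eventually_atTop.1 (Metric.tendsto_nhds.1 hv _ hε')
  have hb : ∀ j, |u (N + j)| ≤ q ^ j * |u N| + ε / 2 := by
    intro j
    induction j with
    | zero => simp; positivity
    | succ j ih =>
      have h1 := h (N + j)
      have h2 := hN (N + j) (by omega)
      rw [Real.dist_eq, sub_zero] at h2
      have h3 := mul_le_mul_of_nonneg_left ih hq0
      rw [← add_assoc, pow_succ]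
      linarith
  have hlim : Tendsto (fun j => q ^ j * |u N|) atTop (𝓝 0) := by
    simpa using (tendsto_pow_atTop_nhds_zero_of_lt_one hq0 hq1).mul_const |u N|
  obtain ⟨J, hJ⟩ := eventually_atTop.1 (hlim.eventually (gt_mem_nhds (show (0:ℝ) < ε / 2 by positivity)))
  refine ⟨N + J, fun n hn => ?_⟩
  obtain ⟨j, rfl⟩ := Nat.exists_eq_add_of_le (show N ≤ n by omega)
  have h1 := hJ j (by omega)
  have h2 := hb j
  rw [Real.dist_eq, sub_zero]
  linarith

lemma centralBinom_succ_le_four_mul (m : ℕ) :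
    ((m + 1).centralBinom : ℝ) ≤ 4 * (m.centralBinom : ℝ) := by
  have h2 : ((m : ℝ) + 1) * ((m + 1).centralBinom : ℝ) = 2 * (2 * m + 1) * m.centralBinom := by
    exact_mod_cast Nat.succ_mul_centralBinom_succ m
  have h3 : (0 : ℝ) < (m : ℝ) + 1 := by positivity
  have h4 : (0 : ℝ) ≤ m.centralBinom := by positivity
  nlinarith

/-- `pairCoeff` grows like a positive multiple of `(2 + √5) ^ m`. -/
lemma exists_tendsto_pairCoeff_div_pow :
    ∃ A : ℝ, 0 < A ∧ Tendsto (fun m => pairCoeff m / (2 + √5) ^ m) atTop (𝓝 A) := by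
  set α : ℝ := 2 + √5 with hα
  have h5 : √5 ^ 2 = (5 : ℝ) := Real.sq_sqrt (by norm_num)
  have hα4 : 4 < α := by
    have : (2 : ℝ) < √5 := by rw [Real.lt_sqrt (by norm_num)]; norm_num
    linarith
  have hα0 : 0 < α := by linarith
  have hαq : α ^ 2 = 4 * α + 1 := by rw [hα]; linear_combination h5
  have hαi : 4 + α⁻¹ = α := by field_simp; linarith
  -- The other characteristic root is `-α⁻¹`; this combination removes it and leaves a first-order
  -- recurrence for `d`.
  set d : ℕ → ℝ := fun m => pairCoeff (m + 1) + α⁻¹ * pairCoeff m with hd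
  have hds : ∀ m, d (m + 1) = α * d m +
      (((m + 2).centralBinom : ℝ) - 4 * ((m + 1).centralBinom : ℝ)) := by
    intro m
    simp only [hd]
    rw [pairCoeff_add_two, mul_add, ← mul_assoc, mul_inv_cancel₀ hα0.ne']
    linear_combination pairCoeff (m + 1) * hαi
  have hd0 : d 0 = 3 + α⁻¹ := by
    have : pairCoeff 1 = 3 := by
      rw [pairCoeff_succ_eq]; simp [halfPowerCoeff_zero_right, Nat.centralBinom]; norm_num
    simp only [hd]
    rw [zero_add, this, pairCoeff_zero, mul_one]
  -- The central binomial is added to make the induction close: since `α > 4`, it pays for the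
  -- negative term `-4 * centralBinom`.
  have hlow : ∀ m, α ^ m + ((m + 1).centralBinom : ℝ) ≤ d m := by
    intro m
    induction m with
    | zero =>
      rw [hd0]
      have : 0 < α⁻¹ := by positivity
      simp [Nat.centralBinom]
      linarith
    | succ m ih =>
      rw [hds, pow_succ]
      have h1 := mul_le_mul_of_nonneg_left ih hα0.le
      have h2 : 4 * ((m + 1).centralBinom : ℝ) ≤ α * (m + 1).centralBinom := by gcongr
      linarith
  have hanti : Antitone fun m => d m / α ^ m := by
    refine antitone_nat_of_succ_le fun m => ?_
    rw [pow_succ, div_le_div_iff₀ (by positivity) (by positivity), hds]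
    have h1 := centralBinom_succ_le_four_mul (m + 1)
    have h2 : (((m + 2).centralBinom : ℝ) - 4 * ((m + 1).centralBinom : ℝ)) * α ^ m ≤ 0 :=
      mul_nonpos_of_nonpos_of_nonneg (by linarith) (by positivity)
    linarith
  have hge : ∀ m, 1 ≤ d m / α ^ m := by
    intro m
    rw [le_div_iff₀ (by positivity), one_mul]
    have : (0 : ℝ) ≤ (m + 1).centralBinom := by positivity
    linarith [hlow m]
  have hD := tendsto_atTop_ciInf hanti ⟨1, by rintro _ ⟨m, rfl⟩; exact hge m⟩
  set D := ⨅ m, d m / α ^ m with hDdef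
  have hD1 : 1 ≤ D := le_ciInf hge
  set A : ℝ := D / (α + α⁻¹) with hA
  refine ⟨A, by positivity, ?_⟩
  have hu : Tendsto (fun m => pairCoeff m / α ^ m - A) atTop (𝓝 0) := by
    refine tendsto_zero_of_abs_succ_le (q := α⁻¹ ^ 2)
      (v := fun m => α⁻¹ * (d m / α ^ m - D)) (by positivity) ?_ ?_ fun m => ?_
    · exact pow_lt_one₀ (by positivity) (inv_lt_one_of_one_lt₀ (by linarith)) two_ne_zero
    · simpa using (hD.sub_const D).const_mul α⁻¹
    · have : pairCoeff (m + 1) / α ^ (m + 1) - A =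
          -- The normalised error contracts by `α⁻²`, up to a forcing term that tends to zero.
          -(α⁻¹ ^ 2 * (pairCoeff m / α ^ m - A)) + α⁻¹ * (d m / α ^ m - D) := by
        have hDA : D = A * (α + α⁻¹) := by rw [hA]; field_simp
        rw [hDA]
        simp only [hd]
        field_simp
        ring
      rw [this]
      refine (abs_add_le _ _).trans ?_
      rw [abs_neg, abs_mul, abs_of_nonneg (by positivity : 0 ≤ α⁻¹ ^ 2)]
  simpa using hu.add_const A

/-! ### Counting covers by two increasing sets. -/

section PairsOfIncreasingSubsets

lemma eqOn_of_strictMonoOn_of_image_eq {α : Type} [LinearOrder α] {f g : α → α} {S : Finset α} (hf : StrictMonoOn f S)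
    (hg : StrictMonoOn g S) (h : S.image f = S.image g) : ∀ x ∈ S, f x = g x := by
  have hc : (S.image f).card = S.card :=
    Finset.card_image_of_injOn hf.injOn
  have key : ∀ k : α → α, StrictMonoOn k S → S.image f = S.image k →
      (fun i => k (S.orderEmbOfFin rfl i)) = (S.image f).orderEmbOfFin hc := by
    intro k hk he
    refine Finset.orderEmbOfFin_unique hc (fun i => ?_) fun i j hij => ?_
    · rw [he]
      exact Finset.mem_image_of_mem _ (Finset.orderEmbOfFin_mem _ _ _)
    · exact hk (Finset.orderEmbOfFin_mem _ _ _) (Finset.orderEmbOfFin_mem _ _ _)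
        ((S.orderEmbOfFin rfl).strictMono hij)
  intro x hx
  obtain ⟨i, rfl⟩ : x ∈ Set.range (S.orderEmbOfFin rfl) := by
    rw [Finset.range_orderEmbOfFin]; exact hx
  exact congrFun ((key f hf rfl).trans (key g hg h).symm) i

variable {α : Type} [Fintype α] [LinearOrder α]

open Classical in
-- Such a `σ` is determined by the image of `S`, which can be any set of the same size.
lemma card_perm_strictMonoOn_compl (S : Finset α) :
    (Finset.univ.filter fun σ : Equiv.Perm α =>
      StrictMonoOn σ S ∧ StrictMonoOn σ (Sᶜ : Finset α)).card =
      (Fintype.card α).choose S.card := by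
  rw [← Finset.card_univ, ← Finset.card_powersetCard]
  refine Finset.card_bij (fun σ _ => S.image σ) ?_ ?_ ?_
  · intro σ _
    simp [Finset.mem_powersetCard, Finset.card_image_of_injective _ σ.injective]
  · intro σ hσ τ hτ h
    simp only [Finset.mem_filter, Finset.mem_univ, true_and] at hσ hτ
    have h' : Sᶜ.image σ = Sᶜ.image τ := by
      have hcompl : ∀ ρ : Equiv.Perm α, Sᶜ.image ρ = (S.image ρ)ᶜ := fun ρ => by
        ext a
        simp only [Finset.mem_image, Finset.mem_compl]
        refine ⟨?_, fun ha => ⟨ρ.symm a, fun h => ha ⟨_, h, by simp⟩, by simp⟩⟩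
        rintro ⟨b, hb, rfl⟩ ⟨c, hc, hcb⟩
        exact hb (ρ.injective hcb ▸ hc)
      rw [hcompl, hcompl, h]
    ext x
    by_cases hx : x ∈ S
    · exact eqOn_of_strictMonoOn_of_image_eq hσ.1 hτ.1 h x hx
    · exact eqOn_of_strictMonoOn_of_image_eq hσ.2 hτ.2 h' x (Finset.mem_compl.2 hx)
  · intro S' hS'
    have hc : S'.card = S.card := (Finset.mem_powersetCard.1 hS').2
    have hc' : S'ᶜ.card = Sᶜ.card := by rw [Finset.card_compl, Finset.card_compl, hc]
    set e : S ≃o S' := (S.orderIsoOfFin rfl).symm.trans (S'.orderIsoOfFin hc)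
    set e' : (Sᶜ : Finset α) ≃o (S'ᶜ : Finset α) :=
      (Sᶜ.orderIsoOfFin rfl).symm.trans (S'ᶜ.orderIsoOfFin hc')
    set f : α → α := fun x => if hx : x ∈ S then e ⟨x, hx⟩ else e' ⟨x, Finset.mem_compl.2 hx⟩
      with hf
    have hfS : ∀ x (hx : x ∈ S), f x = e ⟨x, hx⟩ := fun x hx => by simp [hf, hx]
    have hfC : ∀ x (hx : x ∈ Sᶜ), f x = e' ⟨x, hx⟩ := fun x hx => by
      have : x ∉ S := Finset.mem_compl.1 hx
      simp [hf, this]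
    have hmS : ∀ x, x ∈ S → f x ∈ S' := fun x hx => by rw [hfS x hx]; exact (e _).2
    have hmC : ∀ x, x ∉ S → f x ∉ S' := fun x hx => by
      rw [hfC x (Finset.mem_compl.2 hx)]; exact Finset.mem_compl.1 (e' _).2
    have hinj : Function.Injective f := by
      intro x y hxy
      by_cases hx : x ∈ S <;> by_cases hy : y ∈ S
      · rw [hfS x hx, hfS y hy] at hxy
        simpa using hxy
      · exact absurd (hxy ▸ hmS x hx) (hmC y hy)
      · exact absurd (hxy ▸ hmS y hy) (hmC x hx)
      · rw [hfC x (Finset.mem_compl.2 hx), hfC y (Finset.mem_compl.2 hy)] at hxy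
        simpa using hxy
    refine ⟨Equiv.ofBijective f (Finite.injective_iff_bijective.1 hinj), ?_, ?_⟩
    · simp only [Finset.mem_filter, Finset.mem_univ, true_and]
      constructor
      · intro x hx y hy hxy
        simp only [Equiv.ofBijective_apply]
        rw [hfS x hx, hfS y hy]
        exact_mod_cast e.strictMono (show (⟨x, hx⟩ : S) < ⟨y, hy⟩ from hxy)
      · intro x hx y hy hxy
        simp only [Equiv.ofBijective_apply]
        rw [hfC x hx, hfC y hy]
        exact_mod_cast e'.strictMono (show (⟨x, hx⟩ : (Sᶜ : Finset α)) < ⟨y, hy⟩ from hxy)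
    · apply Finset.eq_of_subset_of_card_le
      · intro y hy
        obtain ⟨x, hx, rfl⟩ := Finset.mem_image.1 hy
        exact hmS x hx
      · rw [Finset.card_image_of_injective _ (Equiv.injective _), hc]

variable (α) in
open Classical in
/-- The permutations `σ` with a cover `(S, T)` of all positions by two sets on which `σ`
increases. -/
noncomputable def increasingCovers : Finset (Equiv.Perm α × Finset α × Finset α) :=
  Finset.univ.filter fun x => x.2.1 ∪ x.2.2 = Finset.univ ∧ StrictMonoOn x.1 x.2.1 ∧
    StrictMonoOn x.1 x.2.2

lemma mem_increasingCovers {x : Equiv.Perm α × Finset α × Finset α} :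
    x ∈ increasingCovers α ↔ (∀ a, a ∈ x.2.1 ∨ a ∈ x.2.2) ∧ StrictMonoOn x.1 x.2.1 ∧
      StrictMonoOn x.1 x.2.2 := by
  simp [increasingCovers, Finset.ext_iff]

variable (α) in
open Classical in
/-- The increasing covers by two disjoint sets. -/
noncomputable def disjointIncreasingCovers : Finset (Equiv.Perm α × Finset α × Finset α) :=
  (increasingCovers α).filter fun x => ∀ a, ¬ (a ∈ x.2.1 ∧ a ∈ x.2.2)

/-- Here `T` is the complement of `S`, so the count is `∑ C(n,k)^2`. -/
lemma card_disjointIncreasingCovers :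
    (disjointIncreasingCovers α).card = (Fintype.card α).centralBinom := by
  classical
  have h1 : (disjointIncreasingCovers α).card = ((Finset.univ : Finset (Finset α)).sigma
      fun S => Finset.univ.filter fun σ : Equiv.Perm α =>
      StrictMonoOn σ S ∧ StrictMonoOn σ (Sᶜ : Finset α)).card := by
    have hT : ∀ x ∈ disjointIncreasingCovers α, x.2.2 = x.2.1ᶜ := by
      intro x hx
      simp only [disjointIncreasingCovers, Finset.mem_filter, mem_increasingCovers] at hx
      ext a
      have h1 := hx.1.1 a
      have h2 := hx.2 a
      rw [Finset.mem_compl]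
      tauto
    refine Finset.card_bij (fun x _ => ⟨x.2.1, x.1⟩) ?_ ?_ ?_
    · intro x hx
      have h := hT x hx
      simp only [disjointIncreasingCovers, Finset.mem_filter, mem_increasingCovers] at hx
      simp only [Finset.mem_sigma, Finset.mem_univ, Finset.mem_filter, true_and]
      rw [← h]
      exact hx.1.2
    · intro x hx y hy h
      simp only [Sigma.mk.injEq, heq_eq_eq] at h
      refine Prod.ext h.2 (Prod.ext h.1 ?_)
      rw [hT x hx, hT y hy, h.1]
    · rintro ⟨S, σ⟩ h
      simp only [Finset.mem_sigma, Finset.mem_univ, Finset.mem_filter, true_and] at h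
      refine ⟨(σ, S, Sᶜ), ?_, rfl⟩
      simp only [disjointIncreasingCovers, Finset.mem_filter, mem_increasingCovers]
      refine ⟨⟨fun a => ?_, h⟩, fun a => ?_⟩
      · rw [Finset.mem_compl]; exact em _
      · rw [Finset.mem_compl]; tauto
  rw [h1, Finset.card_sigma]
  simp only [card_perm_strictMonoOn_compl]
  rw [← Finset.powerset_univ, Finset.sum_powerset_apply_card fun k => (Fintype.card α).choose k,
    Finset.card_univ, Nat.centralBinom_eq_two_mul_choose, ← Nat.sum_range_choose_sq]
  simp [sq]

open Classical in
/-- The increasing covers `(σ, S, T)` for which `p` is the least element of `S ∩ T`. -/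
noncomputable def increasingCoversAt (p : α) : Finset (Equiv.Perm α × Finset α × Finset α) :=
  (increasingCovers α).filter fun x => (p ∈ x.2.1 ∧ p ∈ x.2.2) ∧
    ∀ a < p, ¬ (a ∈ x.2.1 ∧ a ∈ x.2.2)

lemma mem_increasingCoversAt {p : α} {x : Equiv.Perm α × Finset α × Finset α} :
    x ∈ increasingCoversAt p ↔ x ∈ increasingCovers α ∧ (p ∈ x.2.1 ∧ p ∈ x.2.2) ∧
    ∀ a < p, ¬ (a ∈ x.2.1 ∧ a ∈ x.2.2) := by
  simp [increasingCoversAt]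

lemma card_increasingCovers_eq_add_sum :
    (increasingCovers α).card = (disjointIncreasingCovers α).card +
      ∑ p : α, (increasingCoversAt p).card := by
  classical
  rw [← Finset.card_biUnion, ← Finset.card_union_of_disjoint]
  · congr 1
    ext x
    simp only [disjointIncreasingCovers, increasingCoversAt, Finset.mem_union, Finset.mem_filter,
      Finset.mem_biUnion, Finset.mem_univ, true_and]
    constructor
    · intro hx
      by_cases h : ∃ a, a ∈ x.2.1 ∧ a ∈ x.2.2
      · right
        have hne : (x.2.1 ∩ x.2.2).Nonempty := by
          obtain ⟨a, ha⟩ := h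
          exact ⟨a, Finset.mem_inter.2 ha⟩
        refine ⟨(x.2.1 ∩ x.2.2).min' hne, hx, ?_, fun a ha hax => ?_⟩
        · exact Finset.mem_inter.1 (Finset.min'_mem _ hne)
        · exact absurd (Finset.min'_le _ a (Finset.mem_inter.2 hax)) (not_le.2 ha)
      · left
        exact ⟨hx, not_exists.1 h⟩
    · rintro (h | ⟨p, h⟩)
      · exact h.1
      · exact h.1
  · rw [Finset.disjoint_left]
    intro x hx hx'
    simp only [disjointIncreasingCovers, increasingCoversAt, Finset.mem_filter,
      Finset.mem_biUnion, Finset.mem_univ, true_and] at hx hx'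
    obtain ⟨p, h⟩ := hx'
    exact hx.2 p h.2.1
  · intro p _ q _ hpq
    rw [Function.onFun, Finset.disjoint_left]
    intro x hx hx'
    rw [mem_increasingCoversAt] at hx hx'
    rcases lt_or_gt_of_ne hpq with h | h
    · exact hx'.2.2 p h hx.2.1
    · exact hx.2.2 q h hx'.2.1

/-- Every position shares `S` or `T` with `p`, so `σ` preserves its order relative to `p`. Hence `σ`
fixes `p` and preserves both sides of it. -/
lemma lt_iff_of_mem_increasingCovers {p : α} {x : Equiv.Perm α × Finset α × Finset α}
    (hx : x ∈ increasingCovers α) (hp : p ∈ x.2.1 ∧ p ∈ x.2.2) :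
    x.1 p = p ∧ (∀ a, x.1 a < p ↔ a < p) ∧ ∀ a, p < x.1 a ↔ p < a := by
  rw [mem_increasingCovers] at hx
  obtain ⟨hc, hS, hT⟩ := hx
  have hlt : ∀ a, a < p → x.1 a < x.1 p := fun a ha => by
    rcases hc a with h | h
    · exact hS h hp.1 ha
    · exact hT h hp.2 ha
  have hgt : ∀ a, p < a → x.1 p < x.1 a := fun a ha => by
    rcases hc a with h | h
    · exact hS hp.1 h ha
    · exact hT hp.2 h ha
  have hiff : ∀ a, x.1 a < x.1 p ↔ a < p := by
    intro a
    refine ⟨fun h => ?_, hlt a⟩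
    by_contra hn
    rcases (not_lt.1 hn).eq_or_lt with rfl | h'
    · exact lt_irrefl _ h
    · exact lt_asymm h (hgt a h')
  have hiff' : ∀ a, x.1 p < x.1 a ↔ p < a := by
    intro a
    refine ⟨fun h => ?_, hgt a⟩
    by_contra hn
    rcases (not_lt.1 hn).eq_or_lt with rfl | h'
    · exact lt_irrefl _ h
    · exact lt_asymm h (hlt a h')
  -- `σ` maps the points below `p` bijectively onto those below `σ p`; equal counts force `σ p = p`.
  have hcard : (Finset.univ.filter (· < p)).card = (Finset.univ.filter (· < x.1 p)).card := by
    refine Finset.card_bij (fun a _ => x.1 a) ?_ ?_ ?_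
    · intro a ha
      simpa [hiff] using ha
    · intro a _ b _ h
      exact x.1.injective h
    · intro b hb
      refine ⟨x.1.symm b, ?_, by simp⟩
      have := hiff (x.1.symm b)
      simp only [Equiv.apply_symm_apply] at this
      simpa [← this] using hb
  have hfix : x.1 p = p := by
    rcases lt_trichotomy (x.1 p) p with h | h | h
    · exfalso
      refine absurd hcard (ne_of_gt (Finset.card_lt_card ?_))
      refine ⟨fun a ha => ?_, fun hh => ?_⟩
      · simp only [Finset.mem_filter, Finset.mem_univ, true_and] at ha ⊢
        exact ha.trans h
      · have : x.1 p ∈ Finset.univ.filter (· < p) := by simpa using h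
        simpa using hh this
    · exact h
    · exfalso
      refine absurd hcard (ne_of_lt (Finset.card_lt_card ?_))
      refine ⟨fun a ha => ?_, fun hh => ?_⟩
      · simp only [Finset.mem_filter, Finset.mem_univ, true_and] at ha ⊢
        exact ha.trans h
      · have : p ∈ Finset.univ.filter (· < x.1 p) := by simpa using h
        simpa using hh this
  refine ⟨hfix, fun a => ?_, fun a => ?_⟩
  · rw [← hiff a, hfix]
  · rw [← hiff' a, hfix]

end PairsOfIncreasingSubsets

lemma mem_disjointIncreasingCovers {α : Type} [Fintype α] [LinearOrder α]
    {x : Equiv.Perm α × Finset α × Finset α} :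
    x ∈ disjointIncreasingCovers α ↔ x ∈ increasingCovers α ∧ ∀ a, ¬ (a ∈ x.2.1 ∧ a ∈ x.2.2) := by
  simp [disjointIncreasingCovers]

lemma strictMonoOn_glue {α : Type} [LinearOrder α] {p : α} {σ : Equiv.Perm α} {σ₁ : Equiv.Perm {x // x < p}}
    {σ₂ : Equiv.Perm {x // p < x}} {S : Finset α} {S₁ : Finset {x // x < p}}
    {S₂ : Finset {x // p < x}} (h₁ : ∀ x (hx : x < p), σ x = σ₁ ⟨x, hx⟩)
    (h₂ : ∀ x (hx : p < x), σ x = σ₂ ⟨x, hx⟩) (hp : σ p = p)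
    (hS₁ : ∀ x (hx : x < p), x ∈ S ↔ ⟨x, hx⟩ ∈ S₁)
    (hS₂ : ∀ x (hx : p < x), x ∈ S ↔ ⟨x, hx⟩ ∈ S₂)
    (hm₁ : StrictMonoOn σ₁ S₁) (hm₂ : StrictMonoOn σ₂ S₂) : StrictMonoOn σ S := by
  have hlt : ∀ x, x < p → σ x < p := fun x hx => by rw [h₁ x hx]; exact (σ₁ _).2
  have hgt : ∀ x, p < x → p < σ x := fun x hx => by rw [h₂ x hx]; exact (σ₂ _).2
  intro x hx y hy hxy
  rcases lt_trichotomy x p with hxp | rfl | hxp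
  · rcases lt_trichotomy y p with hyp | rfl | hyp
    · rw [h₁ x hxp, h₁ y hyp]
      exact hm₁ ((hS₁ x hxp).1 hx) ((hS₁ y hyp).1 hy) hxy
    · rw [hp]; exact hlt x hxp
    · exact (hlt x hxp).trans (hgt y hyp)
  · rw [hp]; exact hgt y hxy
  · have hyp := hxp.trans hxy
    rw [h₂ x hxp, h₂ y hyp]
    exact hm₂ ((hS₂ x hxp).1 hx) ((hS₂ y hyp).1 hy) hxy

/-- A cover splits at `p` into its two sides. Minimality of `p` makes the lower side disjoint and
leaves the upper side unrestricted; conversely any two sides glue. -/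
lemma card_increasingCoversAt {α : Type} [Fintype α] [LinearOrder α] (p : α) :
    (increasingCoversAt p).card = (disjointIncreasingCovers {x // x < p}).card *
      (increasingCovers {x // p < x}).card := by
  classical
  rw [← Finset.card_product]
  have hkey : ∀ x ∈ increasingCoversAt p, x.1 p = p ∧ (∀ a, x.1 a < p ↔ a < p) ∧
      ∀ a, p < x.1 a ↔ p < a := fun x hx => by
    rw [mem_increasingCoversAt] at hx
    exact lt_iff_of_mem_increasingCovers hx.1 hx.2.1
  refine Finset.card_bij (fun x hx =>
    (((x.1.subtypePerm (hkey x hx).2.1, x.2.1.subtype _, x.2.2.subtype _) :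
      Equiv.Perm {x // x < p} × Finset {x // x < p} × Finset {x // x < p}),
    ((x.1.subtypePerm (hkey x hx).2.2, x.2.1.subtype _, x.2.2.subtype _) :
      Equiv.Perm {x // p < x} × Finset {x // p < x} × Finset {x // p < x}))) ?_ ?_ ?_
  · intro x hx
    rw [mem_increasingCoversAt, mem_increasingCovers] at hx
    simp only [Finset.mem_product, mem_disjointIncreasingCovers, mem_increasingCovers,
      Finset.mem_subtype]
    obtain ⟨⟨hc, hS, hT⟩, -, hd⟩ := hx
    refine ⟨⟨⟨fun a => hc a, ?_, ?_⟩, fun a => hd a a.2⟩, fun a => hc a, ?_, ?_⟩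
    · exact fun a ha b hb hab => hS (Finset.mem_subtype.1 ha) (Finset.mem_subtype.1 hb) hab
    · exact fun a ha b hb hab => hT (Finset.mem_subtype.1 ha) (Finset.mem_subtype.1 hb) hab
    · exact fun a ha b hb hab => hS (Finset.mem_subtype.1 ha) (Finset.mem_subtype.1 hb) hab
    · exact fun a ha b hb hab => hT (Finset.mem_subtype.1 ha) (Finset.mem_subtype.1 hb) hab
  · intro x hx y hy h
    have hx' := hkey x hx
    have hy' := hkey y hy
    rw [mem_increasingCoversAt] at hx hy
    simp only [Prod.mk.injEq] at h
    obtain ⟨⟨h1, h2, h3⟩, h4, h5, h6⟩ := h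
    have hset : ∀ S T : Finset α, p ∈ S → p ∈ T → S.subtype (· < p) = T.subtype (· < p) →
        S.subtype (p < ·) = T.subtype (p < ·) → S = T := by
      intro S T hS hT h h'
      ext a
      rcases lt_trichotomy a p with ha | rfl | ha
      · simpa using Finset.ext_iff.1 h ⟨a, ha⟩
      · simp [hS, hT]
      · simpa using Finset.ext_iff.1 h' ⟨a, ha⟩
    refine Prod.ext ?_ (Prod.ext ?_ ?_)
    · ext a
      rcases lt_trichotomy a p with ha | rfl | ha
      · simpa using congrArg Subtype.val (Equiv.ext_iff.1 h1 ⟨a, ha⟩)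
      · rw [hx'.1, hy'.1]
      · simpa using congrArg Subtype.val (Equiv.ext_iff.1 h4 ⟨a, ha⟩)
    · exact hset _ _ hx.2.1.1 hy.2.1.1 h2 h5
    · exact hset _ _ hx.2.1.2 hy.2.1.2 h3 h6
  · rintro ⟨⟨σ₁, S₁, T₁⟩, ⟨σ₂, S₂, T₂⟩⟩ h
    simp only [Finset.mem_product, mem_disjointIncreasingCovers, mem_increasingCovers] at h
    obtain ⟨⟨⟨hc₁, hS₁, hT₁⟩, hd⟩, hc₂, hS₂, hT₂⟩ := h
    set σ : Equiv.Perm α := Equiv.Perm.ofSubtype σ₁ * Equiv.Perm.ofSubtype σ₂ with hσ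
    have hσ₁ : ∀ x (hx : x < p), σ x = σ₁ ⟨x, hx⟩ := fun x hx => by
      rw [hσ, Equiv.Perm.mul_apply, Equiv.Perm.ofSubtype_apply_of_not_mem σ₂ (not_lt.2 hx.le),
        Equiv.Perm.ofSubtype_apply_of_mem σ₁ hx]
    have hσ₂ : ∀ x (hx : p < x), σ x = σ₂ ⟨x, hx⟩ := fun x hx => by
      rw [hσ, Equiv.Perm.mul_apply, Equiv.Perm.ofSubtype_apply_of_mem σ₂ hx,
        Equiv.Perm.ofSubtype_apply_of_not_mem σ₁ (not_lt.2 (σ₂ _).2.le)]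
    have hσp : σ p = p := by
      rw [hσ, Equiv.Perm.mul_apply, Equiv.Perm.ofSubtype_apply_of_not_mem σ₂ (lt_irrefl p),
        Equiv.Perm.ofSubtype_apply_of_not_mem σ₁ (lt_irrefl p)]
    set glue : Finset {x // x < p} → Finset {x // p < x} → Finset α := fun S S' =>
      insert p (S.map (Function.Embedding.subtype _) ∪ S'.map (Function.Embedding.subtype _))
      with hglue
    have hg₁ : ∀ S S' x (hx : x < p), x ∈ glue S S' ↔ ⟨x, hx⟩ ∈ S := fun S S' x hx => by
      simp [hglue, hx, hx.ne, hx.not_gt]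
    have hg₂ : ∀ S S' x (hx : p < x), x ∈ glue S S' ↔ ⟨x, hx⟩ ∈ S' := fun S S' x hx => by
      simp [hglue, hx, hx.ne', hx.not_gt]
    have hgp : ∀ S S', p ∈ glue S S' := fun S S' => by simp [hglue]
    refine ⟨(σ, glue S₁ S₂, glue T₁ T₂), ?_, ?_⟩
    · rw [mem_increasingCoversAt, mem_increasingCovers]
      refine ⟨⟨fun a => ?_, ?_, ?_⟩, ⟨hgp _ _, hgp _ _⟩, fun a ha => ?_⟩
      · rcases lt_trichotomy a p with ha | rfl | ha
        · rw [hg₁ _ _ a ha, hg₁ _ _ a ha]; exact hc₁ _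
        · exact Or.inl (hgp _ _)
        · rw [hg₂ _ _ a ha, hg₂ _ _ a ha]; exact hc₂ _
      · exact strictMonoOn_glue hσ₁ hσ₂ hσp (hg₁ _ _) (hg₂ _ _) hS₁ hS₂
      · exact strictMonoOn_glue hσ₁ hσ₂ hσp (hg₁ _ _) (hg₂ _ _) hT₁ hT₂
      · rw [hg₁ _ _ a ha, hg₁ _ _ a ha]; exact hd _
    · refine Prod.ext (Prod.ext ?_ (Prod.ext ?_ ?_)) (Prod.ext ?_ (Prod.ext ?_ ?_))
      · ext a; simp [hσ₁ a a.2]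
      · ext a; rw [Finset.mem_subtype]; exact hg₁ _ _ a a.2
      · ext a; rw [Finset.mem_subtype]; exact hg₁ _ _ a a.2
      · ext a; simp [hσ₂ a a.2]
      · ext a; rw [Finset.mem_subtype]; exact hg₂ _ _ a a.2
      · ext a; rw [Finset.mem_subtype]; exact hg₂ _ _ a a.2

lemma sum_card_lt_card_gt {α : Type} [Fintype α] [LinearOrder α] {m : ℕ}
    (hm : Fintype.card α = m + 1) (f : ℕ → ℕ → ℝ) :
    ∑ p : α, f (Fintype.card {x // x < p}) (Fintype.card {x // p < x}) =
      ∑ q ∈ Finset.HasAntidiagonal.antidiagonal m, f q.1 q.2 := by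
  classical
  rw [Finset.Nat.sum_antidiagonal_eq_sum_range_succ f, Finset.sum_range]
  set e : Fin (m + 1) ≃o α := Fintype.orderIsoFinOfCardEq α hm
  rw [← e.toEquiv.sum_comp]
  refine Finset.sum_congr rfl fun i _ => ?_
  have h1 : Fintype.card {x // x < e i} = i := by
    rw [← Fintype.card_fin_lt_of_le (show (i : ℕ) ≤ m + 1 by omega)]
    refine (Fintype.card_congr (e.toEquiv.subtypeEquiv fun a => ?_)).symm
    simp
  have h2 : Fintype.card {x // e i < x} = m - i := by
    have : Fintype.card {x // e i < x} = Fintype.card {x // i < x} := by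
      refine (Fintype.card_congr (e.toEquiv.subtypeEquiv fun a => ?_)).symm
      simp
    rw [this, Fintype.card_subtype]
    have h3 : (Finset.univ.filter fun x => i < x) = Finset.Ioi i := by ext; simp
    rw [h3, Fin.card_Ioi]
    omega
  change f (Fintype.card {x // x < e i}) (Fintype.card {x // e i < x}) = _
  rw [h1, h2]

/-- Cutting at the least common element reproduces `pairCoeff_renewal`, with strong induction
applied to the points above `p`. -/
theorem card_increasingCovers (m : ℕ) : ∀ (α : Type) [Fintype α] [LinearOrder α],
    Fintype.card α = m → ((increasingCovers α).card : ℝ) = pairCoeff m := by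
  induction m using Nat.strong_induction_on with
  | _ m ih =>
    intro α _ _ hα
    rw [card_increasingCovers_eq_add_sum, card_disjointIncreasingCovers, hα]
    cases m with
    | zero =>
      have : IsEmpty α := Fintype.card_eq_zero_iff.1 hα
      simp [pairCoeff_zero]
    | succ m =>
      rw [pairCoeff_renewal, ← sum_card_lt_card_gt hα fun i j => (i.centralBinom : ℝ) * pairCoeff j]
      push_cast
      congr 1
      refine Finset.sum_congr rfl fun p _ => ?_
      rw [card_increasingCoversAt, card_disjointIncreasingCovers]
      push_cast
      congr 1
      refine ih _ ?_ _ rfl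
      rw [← hα]
      exact Fintype.card_subtype_lt (x := p) (lt_irrefl p)

/-! ### First and second moments of the number of increasing sets. -/

open Classical in
/-- The sets of positions along which `τ` increases, the empty set included. -/
noncomputable def increasingSets {n : ℕ} (τ : Equiv.Perm (Fin n)) : Finset (Finset (Fin n)) :=
  Finset.univ.filter fun S => StrictMonoOn τ S

lemma mem_increasingSets {n : ℕ} {τ : Equiv.Perm (Fin n)} {S : Finset (Fin n)} :
    S ∈ increasingSets τ ↔ StrictMonoOn τ S := by
  simp [increasingSets]

lemma strictMonoOn_map_iff {m n : ℕ} (e : Fin m ↪o Fin n) (f : Fin n → Fin n)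
    (S : Finset (Fin m)) :
    StrictMonoOn f (S.map e.toEmbedding : Finset (Fin n)) ↔ StrictMonoOn (f ∘ e) S := by
  constructor
  · intro h a ha b hb hab
    exact h (Finset.mem_map_of_mem _ ha) (Finset.mem_map_of_mem _ hb) (e.strictMono hab)
  · intro h x hx y hy hxy
    obtain ⟨a, ha, rfl⟩ := Finset.mem_map.1 hx
    obtain ⟨b, hb, rfl⟩ := Finset.mem_map.1 hy
    exact h ha hb (e.lt_iff_lt.1 hxy)

lemma card_increasingSets {n : ℕ} (τ : Equiv.Perm (Fin n)) :
    (increasingSets τ).card = increasingSubseqCount n τ + 1 := by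
  classical
  have hfib := Finset.card_eq_sum_card_fiberwise (s := increasingSets τ)
    (t := Finset.range (n + 1)) (f := Finset.card) (fun S _ => by
      have : S.card ≤ n := by simpa using Finset.card_le_univ S
      simpa using this)
  have hI : Finset.range (n + 1) = insert 0 (Finset.Icc 1 n) := by
    ext k; simp; omega
  rw [hfib, hI, Finset.sum_insert (by simp), add_comm, increasingSubseqCount]
  congr 1
  · refine Finset.sum_congr rfl fun k _ => ?_
    rw [← Finset.sum_filter, Finset.sum_const, smul_eq_mul, mul_one]
    symm
    refine Finset.card_bij (fun l _ => Finset.univ.map l.toEmbedding) ?_ ?_ ?_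
    · intro l hl
      rw [Finset.mem_filter, mem_increasingSets, strictMonoOn_map_iff]
      simp only [Finset.mem_filter, Finset.mem_univ, true_and] at hl
      exact ⟨hl.strictMonoOn _, by simp⟩
    · intro l _ l' _ h
      have := congrArg (fun S : Finset (Fin n) => (S : Set (Fin n))) h
      simp only [Finset.coe_map, Finset.coe_univ, Set.image_univ] at this
      exact OrderEmbedding.range_inj.1 this
    · intro S hS
      rw [Finset.mem_filter, mem_increasingSets] at hS
      have hmap : Finset.univ.map (S.orderEmbOfFin hS.2).toEmbedding = S :=
        Finset.coe_injective (by simp)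
      refine ⟨S.orderEmbOfFin hS.2, ?_, hmap⟩
      have h1 := hS.1
      rw [← hmap, strictMonoOn_map_iff] at h1
      simp only [Finset.mem_filter, Finset.mem_univ, true_and]
      rw [Finset.coe_univ, strictMonoOn_univ] at h1
      exact h1
  · rw [Finset.card_eq_one]
    refine ⟨∅, ?_⟩
    ext S
    simp only [Finset.mem_filter, mem_increasingSets, Finset.card_eq_zero, Finset.mem_singleton]
    refine ⟨fun h => h.2, ?_⟩
    rintro rfl
    simp [StrictMonoOn]

/-- The relative order of a uniform permutation along fixed positions is uniform. -/
lemma factorial_mul_sum_perm_comp {m n : ℕ} (e : Fin m ↪ Fin n) (F : (Fin m → Fin n) → ℝ)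
    (G : Equiv.Perm (Fin m) → ℝ) (hF : ∀ (i : Fin m ↪o Fin n) (σ : Equiv.Perm (Fin m)), F (i ∘ σ) = G σ) :
    (m ! : ℝ) * ∑ τ : Equiv.Perm (Fin n), F (τ ∘ e) = n ! * ∑ σ, G σ := by
  classical
  -- A permutation of the chosen positions extends to all positions, so it can be absorbed into `τ`.
  -- Averaging over `ρ` then runs through all relative orders.
  have h1 : ∀ ρ : Equiv.Perm (Fin m), ∑ τ : Equiv.Perm (Fin n), F ((τ ∘ e) ∘ ρ) =
      ∑ τ : Equiv.Perm (Fin n), F (τ ∘ e) := by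
    intro ρ
    refine Eq.trans ?_ (Equiv.sum_comp (Equiv.mulRight (ρ.viaFintypeEmbedding e))
      fun τ => F (τ ∘ e))
    refine Finset.sum_congr rfl fun τ _ => ?_
    congr 1
    funext a
    simp [Equiv.Perm.viaFintypeEmbedding_apply_image]
  have h2 : ∀ f : Fin m → Fin n, Function.Injective f →
      ∑ ρ : Equiv.Perm (Fin m), F (f ∘ ρ) = ∑ σ, G σ := by
    intro f hf
    have hc : (Finset.univ.image f).card = m := by
      rw [Finset.card_image_of_injective _ hf]; simp
    set i := (Finset.univ.image f).orderEmbOfFin hc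
    have hex : ∀ a, ∃ b, i b = f a := by
      intro a
      have : f a ∈ Set.range i := by
        rw [Finset.range_orderEmbOfFin]; simp
      exact this
    choose g hg using hex
    have hgi : Function.Injective g := fun a b hab => hf (by rw [← hg, ← hg, hab])
    set σ₀ : Equiv.Perm (Fin m) := Equiv.ofBijective g (Finite.injective_iff_bijective.1 hgi)
    rw [← Equiv.sum_comp (Equiv.mulLeft σ₀) G]
    refine Finset.sum_congr rfl fun ρ _ => ?_
    rw [← hF i]
    congr 1
    funext a
    exact (hg (ρ a)).symm
  calc (m ! : ℝ) * ∑ τ : Equiv.Perm (Fin n), F (τ ∘ e)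
      = ∑ ρ : Equiv.Perm (Fin m), ∑ τ : Equiv.Perm (Fin n), F ((τ ∘ e) ∘ ρ) := by
        simp only [h1, Finset.sum_const, Finset.card_univ, Fintype.card_perm, Fintype.card_fin,
          nsmul_eq_mul]
    _ = ∑ τ : Equiv.Perm (Fin n), ∑ ρ : Equiv.Perm (Fin m), F ((τ ∘ e) ∘ ρ) := Finset.sum_comm
    _ = ∑ τ : Equiv.Perm (Fin n), ∑ σ, G σ :=
        Finset.sum_congr rfl fun τ _ => h2 _ (τ.injective.comp e.injective)
    _ = n ! * ∑ σ, G σ := by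
        simp only [Finset.sum_const, Finset.card_univ, Fintype.card_perm, Fintype.card_fin,
          nsmul_eq_mul]

lemma strictMonoOn_orderEmb_comp_iff {m n : ℕ} (i : Fin m ↪o Fin n) (f : Fin m → Fin m)
    (S : Set (Fin m)) : StrictMonoOn (i ∘ f) S ↔ StrictMonoOn f S :=
  ⟨fun h _ ha _ hb hab => i.lt_iff_lt.1 (h ha hb hab),
    fun h _ ha _ hb hab => i.strictMono (h ha hb hab)⟩

lemma eq_one_of_strictMono_perm {m : ℕ} {σ : Equiv.Perm (Fin m)} (h : StrictMono σ) : σ = 1 := by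
  have : (StrictMono.orderIsoOfSurjective σ h σ.surjective) = OrderIso.refl _ :=
    Subsingleton.elim _ _
  ext a
  exact congrArg (fun e : Fin m ≃o Fin m => (e a : ℕ)) this

lemma sum_card_increasingSets (n : ℕ) :
    ∑ τ : Equiv.Perm (Fin n), ((increasingSets τ).card : ℝ) =
      n ! * ∑ k ∈ Finset.range (n + 1), (n.choose k : ℝ) / (k ! : ℝ) := by
  classical
  have h1 : ∀ S : Finset (Fin n), ∑ τ : Equiv.Perm (Fin n),
      (if StrictMonoOn τ S then (1 : ℝ) else 0) = n ! * (1 / (S.card ! : ℝ)) := by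
    intro S
    have := factorial_mul_sum_perm_comp (S.orderEmbOfFin rfl).toEmbedding
      (fun f => if StrictMono f then 1 else 0) (fun σ => if StrictMono σ then 1 else 0) (by
        intro i σ
        have := strictMonoOn_orderEmb_comp_iff i σ Set.univ
        rw [strictMonoOn_univ, strictMonoOn_univ] at this
        simp only [this])
    have h2 : ∑ σ : Equiv.Perm (Fin S.card), (if StrictMono σ then (1 : ℝ) else 0) = 1 := by
      rw [Finset.sum_eq_single 1]
      · exact if_pos strictMono_id
      · intro σ _ hσ
        rw [if_neg fun h => hσ (eq_one_of_strictMono_perm h)]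
      · simp
    rw [h2, mul_one] at this
    have h3 : ∀ τ : Equiv.Perm (Fin n), StrictMonoOn τ S ↔
        StrictMono (τ ∘ (S.orderEmbOfFin rfl).toEmbedding) := by
      intro τ
      have hmap : Finset.univ.map (S.orderEmbOfFin rfl).toEmbedding = S :=
        Finset.coe_injective (by simp)
      conv_lhs => rw [← hmap]
      rw [strictMonoOn_map_iff, Finset.coe_univ, strictMonoOn_univ]
      rfl
    simp only [h3]
    rw [← this]
    field_simp
  have h4 : ∀ τ : Equiv.Perm (Fin n), ((increasingSets τ).card : ℝ) =
      ∑ S : Finset (Fin n), if StrictMonoOn τ S then (1 : ℝ) else 0 := by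
    intro τ
    rw [increasingSets, Finset.card_filter]
    push_cast
    rfl
  simp only [h4]
  rw [Finset.sum_comm]
  simp only [h1]
  rw [← Finset.mul_sum, ← Finset.powerset_univ,
    Finset.sum_powerset_apply_card fun k => 1 / (k ! : ℝ)]
  simp [div_eq_mul_inv]

open Classical in
/-- The number of covers of all positions by two sets along which `f` increases. -/
noncomputable def coverCount {m : ℕ} {β : Type} [Preorder β] (f : Fin m → β) : ℕ :=
  (Finset.univ.filter fun x : Finset (Fin m) × Finset (Fin m) =>
    (∀ a, a ∈ x.1 ∨ a ∈ x.2) ∧ StrictMonoOn f x.1 ∧ StrictMonoOn f x.2).card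

lemma sum_coverCount (m : ℕ) :
    ∑ σ : Equiv.Perm (Fin m), (coverCount σ : ℝ) = pairCoeff m := by
  classical
  rw [← card_increasingCovers m (Fin m) (by simp)]
  norm_cast
  simp only [coverCount]
  rw [← Finset.card_sigma]
  refine Finset.card_bij (fun x _ => (x.1, x.2)) ?_ ?_ ?_
  · rintro ⟨σ, S, T⟩ h
    rw [mem_increasingCovers]
    simpa using h
  · rintro ⟨σ, S, T⟩ _ ⟨σ', S', T'⟩ _ h
    simpa using h
  · rintro ⟨σ, S, T⟩ h
    rw [mem_increasingCovers] at h
    exact ⟨⟨σ, S, T⟩, by simpa using h, rfl⟩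

lemma card_pairs_union_eq {n : ℕ} (τ : Equiv.Perm (Fin n)) (U : Finset (Fin n)) :
    ((increasingSets τ ×ˢ increasingSets τ).filter fun x => x.1 ∪ x.2 = U).card =
      coverCount (τ ∘ (U.orderEmbOfFin rfl).toEmbedding) := by
  classical
  set e := U.orderEmbOfFin rfl
  have hmap : Finset.univ.map e.toEmbedding = U := Finset.coe_injective (by simp [e])
  symm
  refine Finset.card_bij (fun x _ => (x.1.map e.toEmbedding, x.2.map e.toEmbedding)) ?_ ?_ ?_
  · rintro ⟨S, T⟩ h
    simp only [Finset.mem_filter, Finset.mem_univ, true_and] at h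
    simp only [Finset.mem_filter, Finset.mem_product, mem_increasingSets, strictMonoOn_map_iff]
    refine ⟨h.2, ?_⟩
    rw [← Finset.map_union]
    refine Eq.trans (congrArg _ ?_) hmap
    ext a
    simpa using h.1 a
  · rintro ⟨S, T⟩ _ ⟨S', T'⟩ _ h
    simpa using h
  · rintro ⟨S, T⟩ h
    simp only [Finset.mem_filter, Finset.mem_product, mem_increasingSets] at h
    obtain ⟨⟨hS, hT⟩, hU⟩ := h
    have hSU : S ⊆ Finset.univ.map e.toEmbedding := by
      rw [hmap, ← hU]; exact Finset.subset_union_left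
    have hTU : T ⊆ Finset.univ.map e.toEmbedding := by
      rw [hmap, ← hU]; exact Finset.subset_union_right
    obtain ⟨S, -, rfl⟩ := Finset.subset_map_iff.1 hSU
    obtain ⟨T, -, rfl⟩ := Finset.subset_map_iff.1 hTU
    rw [strictMonoOn_map_iff] at hS hT
    rw [← Finset.map_union] at hU
    have hU' := Finset.map_injective _ (hU.trans hmap.symm)
    refine ⟨(S, T), ?_, rfl⟩
    simp only [Finset.mem_filter, Finset.mem_univ, true_and]
    refine ⟨fun a => ?_, hS, hT⟩
    rw [← Finset.mem_union, hU']
    exact Finset.mem_univ a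

/-- Pairs are grouped by their union `U`; the order of `τ` on `U` is uniform, so each `U`
contributes `pairCoeff U.card / U.card !` on average. -/
lemma sum_card_increasingSets_sq (n : ℕ) :
    ∑ τ : Equiv.Perm (Fin n), ((increasingSets τ).card : ℝ) ^ 2 =
      n ! * ∑ k ∈ Finset.range (n + 1), (n.choose k : ℝ) / (k ! : ℝ) * pairCoeff k := by
  classical
  have h1 : ∀ U : Finset (Fin n), ∑ τ : Equiv.Perm (Fin n),
      (coverCount (τ ∘ (U.orderEmbOfFin rfl).toEmbedding) : ℝ) =
        n ! * (pairCoeff U.card / (U.card ! : ℝ)) := by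
    intro U
    have := factorial_mul_sum_perm_comp (U.orderEmbOfFin rfl).toEmbedding
      (fun f => (coverCount f : ℝ)) (fun σ => (coverCount σ : ℝ)) (by
        intro i σ
        simp only [coverCount, strictMonoOn_orderEmb_comp_iff]
        congr!)
    rw [sum_coverCount] at this
    rw [← mul_div_assoc, ← this]
    field_simp
  have h4 : ∀ τ : Equiv.Perm (Fin n), ((increasingSets τ).card : ℝ) ^ 2 =
      ∑ U : Finset (Fin n), (coverCount (τ ∘ (U.orderEmbOfFin rfl).toEmbedding) : ℝ) := by
    intro τ
    have := Finset.card_eq_sum_card_fiberwise (s := increasingSets τ ×ˢ increasingSets τ)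
      (t := Finset.univ) (f := fun x => x.1 ∪ x.2) (fun _ _ => by simp)
    rw [Finset.card_product, ← sq] at this
    simp only [card_pairs_union_eq] at this
    exact_mod_cast this
  simp only [h4]
  rw [Finset.sum_comm]
  simp only [h1]
  rw [← Finset.mul_sum, ← Finset.powerset_univ,
    Finset.sum_powerset_apply_card fun k => pairCoeff k / (k ! : ℝ)]
  congr 1
  rw [Finset.card_univ, Fintype.card_fin]
  refine Finset.sum_congr rfl fun k _ => ?_
  rw [nsmul_eq_mul]
  ring

/-! ### Asymptotics of the mean and the variance. -/

/-- The mean number of nonempty increasing subsequences. -/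
noncomputable def increasingMean (n : ℕ) : ℝ :=
  ∑ k ∈ Finset.Icc 1 n, (n.choose k : ℝ) / (k ! : ℝ)

/-- The variance of the number of increasing subsequences. -/
noncomputable def increasingVariance (n : ℕ) : ℝ :=
  ∑ k ∈ Finset.range (n + 1), (n.choose k : ℝ) / (k ! : ℝ) * pairCoeff k -
    (∑ k ∈ Finset.range (n + 1), (n.choose k : ℝ) / (k ! : ℝ)) ^ 2

lemma sum_range_choose_div_factorial (n : ℕ) :
    ∑ k ∈ Finset.range (n + 1), (n.choose k : ℝ) / (k ! : ℝ) = increasingMean n + 1 := by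
  have hI : Finset.range (n + 1) = insert 0 (Finset.Icc 1 n) := by
    ext k; simp; omega
  rw [hI, Finset.sum_insert (by simp), increasingMean]
  simp [add_comm]

lemma laguerreScale_eq {y : ℝ} (hy : 0 < y) (n : ℕ) :
    laguerreScale y n = Real.exp (2 * √y * √n) / (2 * √(Real.pi * √y) * (n : ℝ) ^ (1 / 4 : ℝ)) := by
  have h : (n : ℝ) ^ (1 / 4 : ℝ) = √√(n : ℝ) := by
    rw [Real.sqrt_eq_rpow, Real.sqrt_eq_rpow, ← Real.rpow_mul (by positivity)]
    norm_num
  rw [laguerreScale, h, Real.sqrt_mul hy.le, ← mul_assoc, ← mul_assoc,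
    Real.sqrt_mul (by positivity) (√(n : ℝ)), ← mul_assoc]

lemma laguerreScale_pos {y : ℝ} (hy : 0 < y) {n : ℕ} (hn : 0 < n) : 0 < laguerreScale y n := by
  have hn' : (0 : ℝ) < n := by exact_mod_cast hn
  rw [laguerreScale_eq hy]
  have : 0 < √(Real.pi * √y) := Real.sqrt_pos.2 (mul_pos Real.pi_pos (Real.sqrt_pos.2 hy))
  positivity

lemma tendsto_increasingMean_div_scale :
    Tendsto (fun n => increasingMean n / laguerreScale 1 n) atTop (𝓝 (Real.exp (-(1 / 2)))) := by
  -- The weight vanishes at `k = 0` to leave out the empty subsequence; its limit is unaffected.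
  have h := tendsto_laguerre_sum one_pos (r := fun k => if k = 0 then 0 else 1) (B := 1) (r₀ := 1)
    (fun k => by split_ifs <;> simp)
    (tendsto_const_nhds.congr' (by
      filter_upwards [eventually_gt_atTop 0] with k hk
      rw [if_neg hk.ne']))
  rw [one_mul] at h
  refine h.congr fun n => ?_
  congr 1
  have hI : Finset.range (n + 1) = insert 0 (Finset.Icc 1 n) := by
    ext k; simp; omega
  rw [hI, Finset.sum_insert (by simp), increasingMean]
  simp only [if_true, mul_zero, zero_add, one_pow, mul_one]
  refine Finset.sum_congr rfl fun k hk => ?_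
  have := (Finset.mem_Icc.1 hk).1
  rw [if_neg (by omega), mul_one]

lemma isEquivalent_of_tendsto_div {u s v : ℕ → ℝ} {c : ℝ} (hc : c ≠ 0)
    (hu : Tendsto (fun n => u n / s n) atTop (𝓝 c)) (hs : ∀ n, 0 < n → 0 < s n)
    (hv : ∀ n, v n = c * s n) : u ~[atTop] v := by
  rw [isEquivalent_iff_tendsto_one]
  · have := hu.div_const c
    rw [div_self hc] at this
    refine this.congr fun n => ?_
    simp only [Pi.div_apply]
    rw [hv, div_div, mul_comm c]
  · filter_upwards [eventually_gt_atTop 0] with n hn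
    rw [hv]
    exact mul_ne_zero hc (hs n hn).ne'

lemma increasingMean_isEquivalent :
    increasingMean ~[atTop] (fun n : ℕ =>
      1 / (2 * √(Real.pi * Real.exp 1) * (n : ℝ) ^ (1 / 4 : ℝ)) * Real.exp (2 * √(n : ℝ))) := by
  refine isEquivalent_of_tendsto_div (Real.exp_pos _).ne' tendsto_increasingMean_div_scale
    (fun n hn => laguerreScale_pos one_pos hn) fun n => ?_
  rw [laguerreScale_eq one_pos]
  have h : √(Real.exp 1) = Real.exp (1 / 2) := by
    rw [Real.sqrt_eq_iff_mul_self_eq (Real.exp_pos _).le (Real.exp_pos _).le, ← Real.exp_add]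
    norm_num
  rw [Real.sqrt_mul Real.pi_pos.le, h, Real.exp_neg, Real.sqrt_one, mul_one, mul_one]
  ring

/-- The exponents are `4√n` against `2√y√n`, so `y > 4` is exactly what makes the exponential decay.
-/
lemma tendsto_laguerreScale_one_sq_div {y : ℝ} (hy : 4 < y) :
    Tendsto (fun n => laguerreScale 1 n ^ 2 / laguerreScale y n) atTop (𝓝 0) := by
  have hy0 : 0 < y := by linarith
  have h2 : 2 < √y := by rw [Real.lt_sqrt (by norm_num)]; norm_num [hy]
  have hn : Tendsto (fun n : ℕ => √(n : ℝ)) atTop atTop :=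
    Real.tendsto_sqrt_atTop.comp tendsto_natCast_atTop_atTop
  have he : Tendsto (fun n : ℕ => Real.exp (-((2 * √y - 4) * √(n : ℝ)))) atTop (𝓝 0) :=
    Real.tendsto_exp_neg_atTop_nhds_zero.comp (hn.const_mul_atTop (by linarith))
  have hq : Tendsto (fun n : ℕ => ((n : ℝ) ^ (1 / 4 : ℝ))⁻¹) atTop (𝓝 0) :=
    tendsto_inv_atTop_zero.comp
      ((tendsto_rpow_atTop (by norm_num)).comp tendsto_natCast_atTop_atTop)
  have h := (he.mul hq).const_mul (2 * √(Real.pi * √y) / (2 * √Real.pi) ^ 2)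
  rw [mul_zero, mul_zero] at h
  refine h.congr' ?_
  filter_upwards [eventually_gt_atTop 0] with n hn
  have hn' : (0 : ℝ) < n := by exact_mod_cast hn
  rw [laguerreScale_eq one_pos, laguerreScale_eq hy0]
  have e1 : Real.exp (-((2 * √y - 4) * √(n : ℝ))) =
      Real.exp (2 * √(n : ℝ)) ^ 2 / Real.exp (2 * √y * √n) := by
    rw [← Real.exp_nat_mul, ← Real.exp_sub]
    congr 1
    push_cast
    ring
  rw [e1, Real.sqrt_one, mul_one, mul_one]
  have : (0 : ℝ) < (n : ℝ) ^ (1 / 4 : ℝ) := by positivity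
  have : 0 < √(Real.pi * √y) := Real.sqrt_pos.2 (mul_pos Real.pi_pos (Real.sqrt_pos.2 hy0))
  have : 0 < √Real.pi := Real.sqrt_pos.2 Real.pi_pos
  field_simp

lemma four_lt_two_add_sqrt_five : 4 < 2 + √5 := by
  have : (2 : ℝ) < √5 := by rw [Real.lt_sqrt (by norm_num)]; norm_num
  linarith

lemma tendsto_increasingMean_sq_div_scale {a : ℝ} :
    Tendsto (fun n => (increasingMean n + a) ^ 2 / laguerreScale (2 + √5) n) atTop (𝓝 0) := by
  have hs : Tendsto (fun n => laguerreScale 1 n) atTop atTop := by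
    have hn : Tendsto (fun n : ℕ => √(1 * (n : ℝ))) atTop atTop := by
      simp only [one_mul]
      exact Real.tendsto_sqrt_atTop.comp tendsto_natCast_atTop_atTop
    have h := tendsto_exp_div_rpow_atTop (1 / 2)
    refine tendsto_atTop_mono' _ ?_ ((h.comp hn).const_mul_atTop
      (show (0 : ℝ) < 1 / (2 * √Real.pi) by
        have : 0 < √Real.pi := Real.sqrt_pos.2 Real.pi_pos
        positivity))
    filter_upwards with n
    simp only [Function.comp, laguerreScale]
    rw [Real.sqrt_mul Real.pi_pos.le, ← Real.sqrt_eq_rpow, div_mul_div_comm, one_mul, ← mul_assoc]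
    gcongr
    have : 0 ≤ √(1 * (n : ℝ)) := Real.sqrt_nonneg _
    linarith
  have h1 := ((tendsto_increasingMean_div_scale.add (hs.const_div_atTop a)).pow 2).mul
    (tendsto_laguerreScale_one_sq_div four_lt_two_add_sqrt_five)
  rw [mul_zero] at h1
  refine h1.congr' ?_
  filter_upwards [eventually_gt_atTop 0] with n hn
  have := laguerreScale_pos one_pos hn
  have := laguerreScale_pos (y := 2 + √5) (by positivity) hn
  field_simp

lemma exists_increasingVariance_isEquivalent :
    ∃ C : ℝ, 0 < C ∧ increasingVariance ~[atTop] (fun n : ℕ =>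
      C / (n : ℝ) ^ (1 / 4 : ℝ) * Real.exp (2 * √(2 + √5) * √(n : ℝ))) ∧
      Tendsto (fun n => increasingMean n ^ 2 / increasingVariance n) atTop (𝓝 0) ∧
      ∀ᶠ n in atTop, 0 < increasingVariance n := by
  obtain ⟨A, hA, hlim⟩ := exists_tendsto_pairCoeff_div_pow
  have hα : 0 < 2 + √5 := by positivity
  obtain ⟨B, hB⟩ := (Metric.isBounded_range_of_tendsto _ hlim).exists_norm_le
  -- The powers of `2 + √5` in `pairCoeff` become the Laguerre argument, leaving a bounded
  -- convergent factor.
  have h1 := tendsto_laguerre_sum hα (fun k => hB _ ⟨k, rfl⟩) hlim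
  have hc : 0 < A * Real.exp (-((2 + √5) / 2)) := by positivity
  set c := A * Real.exp (-((2 + √5) / 2)) with hcdef
  have hV : Tendsto (fun n => increasingVariance n / laguerreScale (2 + √5) n) atTop (𝓝 c) := by
    have h2 := h1.sub (tendsto_increasingMean_sq_div_scale (a := 1))
    rw [sub_zero] at h2
    refine h2.congr fun n => ?_
    rw [increasingVariance, sum_range_choose_div_factorial, ← sub_div]
    congr 2
    refine Finset.sum_congr rfl fun k _ => ?_
    field_simp
  have hK : 0 < √(Real.pi * √(2 + √5)) :=
    Real.sqrt_pos.2 (mul_pos Real.pi_pos (Real.sqrt_pos.2 hα))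
  refine ⟨c / (2 * √(Real.pi * √(2 + √5))), by positivity, ?_, ?_, ?_⟩
  · refine isEquivalent_of_tendsto_div hc.ne' hV (fun n hn => laguerreScale_pos hα hn) fun n => ?_
    rw [laguerreScale_eq hα]
    ring
  · have h3 := (tendsto_increasingMean_sq_div_scale (a := 0)).div hV hc.ne'
    rw [zero_div] at h3
    refine h3.congr' ?_
    filter_upwards [eventually_gt_atTop 0] with n hn
    have := (laguerreScale_pos hα hn).ne'
    simp only [Pi.div_apply, add_zero]
    rw [div_div_div_cancel_right₀ this]
  · filter_upwards [hV.eventually (lt_mem_nhds hc), eventually_gt_atTop 0] with n h hn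
    exact (div_pos_iff_of_pos_right (laguerreScale_pos hα hn)).1 h

/-! ### Reduction to a single uniform permutation. -/

/-- Given `i`, the only possible `j` is `(ρ⁻¹ * π) ∘ i`, and it is admissible exactly when it
increases. -/
lemma steeleV_eq_increasingSubseqCount (n : ℕ) (π ρ : Equiv.Perm (Fin n)) :
    steeleV n π ρ = increasingSubseqCount n (ρ⁻¹ * π) := by
  classical
  rw [steeleV, increasingSubseqCount]
  refine Finset.sum_congr rfl fun k _ => Finset.sum_congr rfl fun i _ => ?_
  have hiff : ∀ j : Fin k ↪o Fin n, (∀ s, π (i s) = ρ (j s)) ↔ ∀ s, (ρ⁻¹ * π) (i s) = j s := by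
    intro j
    refine forall_congr' fun s => ?_
    rw [Equiv.Perm.mul_apply, Equiv.Perm.inv_eq_iff_eq]
  by_cases h : StrictMono fun s : Fin k => (ρ⁻¹ * π) (i s)
  · rw [if_pos h, Finset.sum_eq_single (OrderEmbedding.ofStrictMono _ h)]
    · rw [if_pos ((hiff _).2 fun s => rfl)]
    · intro j _ hj
      rw [if_neg]
      intro hc
      apply hj
      ext s
      exact congrArg Fin.val ((hiff j).1 hc s).symm
    · simp
  · rw [if_neg h]
    refine Finset.sum_eq_zero fun j _ => if_neg fun hc => h ?_
    rw [show (fun s : Fin k => (ρ⁻¹ * π) (i s)) = j from funext ((hiff j).1 hc)]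
    exact j.strictMono

instance isProbabilityMeasure_uniformPerm (n : ℕ) : IsProbabilityMeasure (uniformPerm n) := by
  unfold uniformPerm; infer_instance

instance discreteMeasurableSpace_perm (n : ℕ) : DiscreteMeasurableSpace (Equiv.Perm (Fin n)) :=
  ⟨fun _ => trivial⟩

lemma uniformPerm_singleton (n : ℕ) (τ : Equiv.Perm (Fin n)) :
    uniformPerm n {τ} = ((n ! : ℕ) : ENNReal)⁻¹ := by
  rw [uniformPerm, PMF.toMeasure_apply_singleton _ _ (MeasurableSet.of_discrete),
    PMF.uniformOfFintype_apply, Fintype.card_perm, Fintype.card_fin]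

/-- For each value `r` of `ρ`, the event that the product is `τ` is the single point `π = r * τ`,
whose mass does not depend on `r`. -/
lemma map_inv_mul_eq_uniformPerm {Ω : Type*} [MeasurableSpace Ω] {P : Measure Ω}
    [IsProbabilityMeasure P] {n : ℕ} {π ρ : Ω → Equiv.Perm (Fin n)} (hπ : Measurable π)
    (hρ : Measurable ρ) (hu : P.map π = uniformPerm n) (hi : IndepFun π ρ P) :
    P.map (fun ω => (ρ ω)⁻¹ * π ω) = uniformPerm n := by
  have hprod := (indepFun_iff_map_prod_eq_prod_map_map hπ.aemeasurable hρ.aemeasurable).1 hi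
  have hm : Measurable fun p : Equiv.Perm (Fin n) × Equiv.Perm (Fin n) => p.2⁻¹ * p.1 :=
    Measurable.of_discrete
  have hcomp : P.map (fun ω => (ρ ω)⁻¹ * π ω) =
      (P.map fun ω => (π ω, ρ ω)).map fun p => p.2⁻¹ * p.1 := by
    rw [Measure.map_map hm (hπ.prodMk hρ)]
    rfl
  have hPρ : IsProbabilityMeasure (P.map ρ) := Measure.isProbabilityMeasure_map hρ.aemeasurable
  rw [hcomp, hprod, hu]
  refine Measure.ext_of_singleton fun τ => ?_
  rw [Measure.map_apply hm .of_discrete, Measure.prod_apply_symm .of_discrete]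
  have : ∀ r : Equiv.Perm (Fin n), (fun x => (x, r)) ⁻¹'
      ((fun p : Equiv.Perm (Fin n) × Equiv.Perm (Fin n) => p.2⁻¹ * p.1) ⁻¹' {τ}) = {r * τ} := by
    intro r
    ext x
    simp [inv_mul_eq_iff_eq_mul]
  simp only [this, uniformPerm_singleton, lintegral_const, measure_univ, mul_one]

lemma identDistrib_steeleV {Ω : Type*} [MeasurableSpace Ω] {P : Measure Ω}
    [IsProbabilityMeasure P] {n : ℕ} {π ρ : Ω → Equiv.Perm (Fin n)} (hπ : Measurable π)
    (hρ : Measurable ρ) (hu : P.map π = uniformPerm n) (hi : IndepFun π ρ P) :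
    IdentDistrib (fun ω => steeleV n (π ω) (ρ ω)) (increasingSubseqCount n) P (uniformPerm n) := by
  have hm : Measurable fun ω => (ρ ω)⁻¹ * π ω :=
    (Measurable.of_discrete (f := fun p : Equiv.Perm (Fin n) × Equiv.Perm (Fin n) =>
      p.2⁻¹ * p.1)).comp (hπ.prodMk hρ)
  have hid : IdentDistrib (fun ω => (ρ ω)⁻¹ * π ω) id P (uniformPerm n) :=
    ⟨hm.aemeasurable, aemeasurable_id, by
      rw [Measure.map_id, map_inv_mul_eq_uniformPerm hπ hρ hu hi]⟩
  have h := hid.comp (u := increasingSubseqCount n) Measurable.of_discrete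
  have he : (fun ω => steeleV n (π ω) (ρ ω)) =
      increasingSubseqCount n ∘ fun ω => (ρ ω)⁻¹ * π ω :=
    funext fun ω => steeleV_eq_increasingSubseqCount n _ _
  rw [he]
  exact h

lemma integral_uniformPerm (n : ℕ) (f : Equiv.Perm (Fin n) → ℝ) :
    ∫ τ, f τ ∂(uniformPerm n) = (∑ τ, f τ) / n ! := by
  rw [uniformPerm, PMF.integral_eq_sum]
  simp only [PMF.uniformOfFintype_apply, Fintype.card_perm, Fintype.card_fin, ENNReal.toReal_inv,
    ENNReal.toReal_natCast, smul_eq_mul]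
  rw [← Finset.mul_sum, div_eq_inv_mul]

lemma integral_card_increasingSets (n : ℕ) :
    ∫ τ, ((increasingSets τ).card : ℝ) ∂(uniformPerm n) = increasingMean n + 1 := by
  rw [integral_uniformPerm, sum_card_increasingSets, mul_div_cancel_left₀ _ (by positivity),
    sum_range_choose_div_factorial]

lemma increasingSubseqCount_cast_eq (n : ℕ) : (fun τ => (increasingSubseqCount n τ : ℝ)) =
    fun τ => ((increasingSets τ).card : ℝ) - 1 := by
  funext τ
  rw [card_increasingSets]
  push_cast
  ring

lemma integral_increasingSubseqCount (n : ℕ) :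
    ∫ τ, (increasingSubseqCount n τ : ℝ) ∂(uniformPerm n) = increasingMean n := by
  rw [increasingSubseqCount_cast_eq, integral_sub .of_finite .of_finite,
    integral_card_increasingSets]
  simp

lemma variance_increasingSubseqCount (n : ℕ) :
    Var[fun τ => (increasingSubseqCount n τ : ℝ); uniformPerm n] = increasingVariance n := by
  rw [increasingSubseqCount_cast_eq, variance_sub_const .of_discrete,
    variance_eq_sub .of_discrete, integral_card_increasingSets, increasingVariance,
    sum_range_choose_div_factorial]
  congr 1
  simp only [Pi.pow_apply]
  rw [integral_uniformPerm, sum_card_increasingSets_sq, mul_div_cancel_left₀ _ (by positivity)]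

lemma choose_sq_mul_factorial_div {n k : ℕ} (hk : k ≤ n) :
    (n.choose k : ℝ) ^ 2 * (((n - k)! : ℕ) : ℝ) / (n ! : ℝ) = (n.choose k : ℝ) / (k ! : ℝ) := by
  have h : (n.choose k : ℝ) * k ! * (n - k)! = n ! := by
    exact_mod_cast Nat.choose_mul_factorial_mul_factorial hk
  rw [div_eq_div_iff (by positivity) (by positivity), ← h]
  ring

/-- The double sum is regrouped by `m = k + l`, with `multichoose r l = choose (r + l - 1) l`. -/
lemma increasingVariance_eq (n : ℕ) : increasingVariance n =
    (∑ p ∈ Finset.range (n + 1) ×ˢ Finset.range (n + 1) with p.1 + p.2 ≤ n,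
      (4 : ℝ) ^ p.2 * (1 / ((p.1 + p.2)! : ℝ)) * (n.choose (p.1 + p.2) : ℝ) *
        Ring.choose (((p.1 : ℝ) + 1) / 2 + (p.2 : ℝ) - 1) p.2) -
    (∑ k ∈ Finset.Icc 0 n,
      (n.choose k : ℝ) ^ 2 * (((n - k)! : ℕ) : ℝ) / (n ! : ℝ)) ^ 2 := by
  rw [increasingVariance]
  congr 1
  · refine Eq.trans ?_ (Finset.sum_fiberwise_of_maps_to (t := Finset.range (n + 1))
      (g := fun p : ℕ × ℕ => p.1 + p.2) (fun p hp => by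
        have := (Finset.mem_filter.1 hp).2
        simpa [Nat.lt_succ_iff] using this) _)
    refine Finset.sum_congr rfl fun m hm => ?_
    have hm' : m ≤ n := by simpa [Nat.lt_succ_iff] using hm
    rw [pairCoeff, Finset.mul_sum]
    refine Finset.sum_congr ?_ fun p hp => ?_
    · ext ⟨k, l⟩
      simp only [Finset.HasAntidiagonal.mem_antidiagonal, Finset.mem_filter, Finset.mem_product,
        Finset.mem_range]
      omega
    · rw [(Finset.mem_filter.1 hp).2, halfPowerCoeff, Ring.multichoose_eq]
      ring
  · congr 1
    rw [Nat.range_succ_eq_Icc_zero]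
    exact Finset.sum_congr rfl fun k hk =>
      (choose_sq_mul_factorial_div (Finset.mem_Icc.1 hk).2).symm

/-! ### Fluctuations and the final assembly. -/

/-- Markov's inequality for `|X - e| ≤ X + e`, a first-moment bound. Chebyshev's would not tend to
zero at the scale of the standard deviation. -/
lemma measure_fluctuation_le {Ω : Type*} [MeasurableSpace Ω] {P : Measure Ω}
    [IsProbabilityMeasure P] {X : Ω → ℝ} (hX : Integrable X P) (h0 : ∀ ω, 0 ≤ X ω) {σ ε : ℝ}
    (hσ : 0 < σ) (hε : 0 < ε) :
    P {ω | ε < |(X ω - ∫ ω', X ω' ∂P) / σ|} ≤ ENNReal.ofReal (2 / ε * ((∫ ω, X ω ∂P) / σ)) := by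
  set e := ∫ ω, X ω ∂P
  have he : 0 ≤ e := integral_nonneg h0
  have hint : Integrable (fun ω => (X ω + e) / σ) P :=
    (hX.add (integrable_const e)).div_const σ
  have hmark := mul_meas_ge_le_integral_of_nonneg
    (ae_of_all P fun ω => div_nonneg (add_nonneg (h0 ω) he) hσ.le) hint ε
  have hval : ∫ ω, (X ω + e) / σ ∂P = 2 * (e / σ) := by
    rw [integral_div, integral_add hX (integrable_const e)]
    simp only [integral_const, probReal_univ, smul_eq_mul, one_mul]
    ring
  rw [hval] at hmark
  have hsub : {ω | ε < |(X ω - e) / σ|} ⊆ {ω | ε ≤ (X ω + e) / σ} := by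
    intro ω hω
    have hlt : ε < |(X ω - e) / σ| := hω
    refine hlt.le.trans ?_
    rw [abs_div, abs_of_pos hσ]
    gcongr
    refine (abs_sub _ _).trans ?_
    rw [abs_of_nonneg (h0 ω), abs_of_nonneg he]
  refine (measure_mono hsub).trans ?_
  rw [← ofReal_measureReal]
  refine ENNReal.ofReal_le_ofReal ?_
  rw [div_mul_eq_mul_div, le_div_iff₀ hε, mul_comm]
  exact hmark

theorem theorem8p1 :
    ∃ C : ℝ, 0 < C ∧
      ∀ (Ω : ℕ → Type*) [∀ n, MeasurableSpace (Ω n)]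
        (P : (n : ℕ) → Measure (Ω n)) [∀ n, IsProbabilityMeasure (P n)]
        (π ρ : (n : ℕ) → Ω n → Equiv.Perm (Fin n)),
        (∀ n, Measurable (π n)) → (∀ n, Measurable (ρ n)) →
        (∀ n, (P n).map (π n) = uniformPerm n) →
        (∀ n, IndepFun (π n) (ρ n) (P n)) →
        -- equality in law with the number of nonempty increasing subsequences
        (∀ n, IdentDistrib (fun ω => steeleV n (π n ω) (ρ n ω)) (increasingSubseqCount n)
          (P n) (uniformPerm n)) ∧
        -- the exact mean and its asymptotics
        (∀ n, ∫ ω, (steeleV n (π n ω) (ρ n ω) : ℝ) ∂(P n) =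
          ∑ k ∈ Finset.Icc 1 n, (n.choose k : ℝ) ^ 2 * (((n - k)! : ℕ) : ℝ) / (n ! : ℝ)) ∧
        ((fun n : ℕ => ∫ ω, (steeleV n (π n ω) (ρ n ω) : ℝ) ∂(P n)) ~[atTop]
          (fun n : ℕ => 1 / (2 * √(Real.pi * Real.exp 1) * (n : ℝ) ^ (1 / 4 : ℝ)) *
            Real.exp (2 * √(n : ℝ)))) ∧
        -- the exact variance and its asymptotics
        (∀ n, Var[fun ω => (steeleV n (π n ω) (ρ n ω) : ℝ); P n] =
          (∑ p ∈ Finset.range (n + 1) ×ˢ Finset.range (n + 1) with p.1 + p.2 ≤ n,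
            (4 : ℝ) ^ p.2 * (1 / ((p.1 + p.2)! : ℝ)) * (n.choose (p.1 + p.2) : ℝ) *
              Ring.choose (((p.1 : ℝ) + 1) / 2 + (p.2 : ℝ) - 1) p.2) -
          (∑ k ∈ Finset.Icc 0 n,
            (n.choose k : ℝ) ^ 2 * (((n - k)! : ℕ) : ℝ) / (n ! : ℝ)) ^ 2) ∧
        ((fun n : ℕ => Var[fun ω => (steeleV n (π n ω) (ρ n ω) : ℝ); P n]) ~[atTop]
          (fun n : ℕ => C / (n : ℝ) ^ (1 / 4 : ℝ) *
            Real.exp (2 * √(2 + √5) * √(n : ℝ)))) ∧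
        -- the normalised fluctuation tends to `0` in probability
        (∀ ε : ℝ, 0 < ε → Tendsto (fun n : ℕ => P n {ω |
          ε < |((steeleV n (π n ω) (ρ n ω) : ℝ) -
                ∫ ω', (steeleV n (π n ω') (ρ n ω') : ℝ) ∂(P n)) /
              √(Var[fun ω' => (steeleV n (π n ω') (ρ n ω') : ℝ); P n])|}) atTop (𝓝 0)) := by
  obtain ⟨C, hC, hvar, hratio, hpos⟩ := exists_increasingVariance_isEquivalent
  refine ⟨C, hC, ?_⟩
  intro Ω _ P _ π ρ hπ hρ hu hi
  have hlaw := fun n => identDistrib_steeleV (hπ n) (hρ n) (hu n) (hi n)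
  have hreal : ∀ n, IdentDistrib (fun ω => (steeleV n (π n ω) (ρ n ω) : ℝ))
      (fun τ => (increasingSubseqCount n τ : ℝ)) (P n) (uniformPerm n) :=
    fun n => (hlaw n).comp (u := fun m : ℕ => (m : ℝ)) Measurable.of_discrete
  have hmean : ∀ n, ∫ ω, (steeleV n (π n ω) (ρ n ω) : ℝ) ∂(P n) = increasingMean n := fun n => by
    rw [(hreal n).integral_eq, integral_increasingSubseqCount]
  have hVar : ∀ n, Var[fun ω => (steeleV n (π n ω) (ρ n ω) : ℝ); P n] = increasingVariance n :=
    fun n => by rw [(hreal n).variance_eq, variance_increasingSubseqCount]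
  refine ⟨hlaw, fun n => ?_, ?_, fun n => ?_, ?_, fun ε hε => ?_⟩
  · rw [hmean, increasingMean]
    exact Finset.sum_congr rfl fun k hk =>
      (choose_sq_mul_factorial_div (Finset.mem_Icc.1 hk).2).symm
  · simp only [hmean]
    exact increasingMean_isEquivalent
  · rw [hVar, increasingVariance_eq]
  · simp only [hVar]
    exact hvar
  · have hlim : Tendsto (fun n => ENNReal.ofReal
        (2 / ε * (increasingMean n / √(increasingVariance n)))) atTop (𝓝 0) := by
      have h1 := (Real.continuous_sqrt.tendsto _).comp hratio
      rw [Real.sqrt_zero] at h1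
      have h2 : Tendsto (fun n => increasingMean n / √(increasingVariance n)) atTop (𝓝 0) := by
        refine h1.congr fun n => ?_
        have h0 : 0 ≤ increasingMean n := Finset.sum_nonneg fun k _ => by positivity
        rw [Function.comp, Real.sqrt_div (by positivity), Real.sqrt_sq h0]
      have h3 := ENNReal.tendsto_ofReal (h2.const_mul (2 / ε))
      rwa [mul_zero, ENNReal.ofReal_zero] at h3
    refine tendsto_of_tendsto_of_tendsto_of_le_of_le' tendsto_const_nhds hlim
      (Eventually.of_forall fun n => zero_le) ?_
    filter_upwards [hpos] with n hn
    have hint : Integrable (fun ω => (steeleV n (π n ω) (ρ n ω) : ℝ)) (P n) :=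
      (hreal n).integrable_iff.2 .of_finite
    have := measure_fluctuation_le hint (fun ω => Nat.cast_nonneg _) (Real.sqrt_pos.2 hn) hε
    rw [hVar n]
    rwa [hmean n] at this ⊢
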